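/- **Setting.** Let $G$ be a semisimple Lie group contained in a complexification $G_{\mathbb C}$ (for instance its universal complexification), realized as closed groups $G\subseteq G_{\mathbb C}\subseteq GL(n,\mathbb C)$ (a complex semisimple Lie group always has such a realization): the Lie algebra $\mathfrak g$ of $G$ is semisimple and $\mathrm{Lie}(G_{\mathbb C})=\mathfrak g\oplus i\mathfrak g$. Let $\theta$ be a Cartan involution of $G$, so that $K=G^\theta$ is a maximal compact subgroup, and write $\theta$ also for its differential on $\mathfrak g$, with eigenspace decomposition $\mathfrak g=\mathfrak k\oplus\mathfrak p$, and for its extension to an involutive holomorphic automorphism of $G_{\mathbb C}$ (assumed to exist; it always does for the universal complexification). Assume that $\mathfrak g$ is non-compact, i.e. $\mathfrak p\neq 0$. Let $K_{\mathbb C}\subseteq G_{\mathbb C}$ be the complexification of $K$, i.e. the subgroup generated by $K$ and $\exp(i\mathfrak k)$. Let $\mathfrak a\subseteq\mathfrak p$ be maximal abelian, $\Sigma\subseteq\mathfrak a^*\setminus\{0\}$ the set of restricted roots, $\Omega=\{X\in\mathfrak a:\ |\alpha(X)|<\pi/2\ \text{for all}\ \alpha\in\Sigma\}$, $\partial_e\Omega$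 the set of extreme points of $\overline\Omega$, and $$\partial_d\Xi=G\exp(i\,\partial_e\Omega)K_{\mathbb C}/K_{\mathbb C}\subseteq G_{\mathbb C}/K_{\mathbb C}.$$ Let $\tau$ be an involution of a semisimple Lie algebra $\mathfrak l$ commuting with a Cartan involution $\theta$ of $\mathfrak l$, and suppose that the only $\tau$-invariant ideals of $\mathfrak l$ are $0$ and $\mathfrak l$. Then $(\mathfrak l,\tau)$ is called *non-compactly causal* if there is $0\ne Y_0\in\mathfrak l$ with $\tau(Y_0)=\theta(Y_0)=-Y_0$ which commutes with every $X\in\mathfrak l$ such that $\tau(X)=\theta(X)=X$. **Theorem 3.5.** Let $Y\in\partial_e\Omega$, $z=\exp(iY)$, $z'=zK_{\mathbb C}$, and let $\tau:G_{\mathbb C}\to G_{\mathbb C}$, $\tau(g)=z^2\theta(g)z^{-2}$. (i) If $d\tau(\mathbf 1)$ maps $\mathfrak g$ into itself, then $\operatorname{Spec}(\operatorname{ad}Y)=\{-\pi/2,0,\pi/2\}$ (complex spectrum), the restriction of $d\tau(\mathbf 1)$ to $\mathfrak g$, again denoted $\tau$, is an involution (an automorphism of order two) of the Lie algebra $\mathfrak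 g$, and if $\mathfrak g$ is simple, then $(\mathfrak g,\tau)$ is non-compactly causal. More generally, without assuming $\mathfrak g$ simple, every simple ideal $\mathfrak j$ of $\mathfrak g$ with $\mathfrak j\not\subseteq\mathfrak k$ is stable under $\tau$ and $\theta$, and $(\mathfrak j,\tau|_{\mathfrak j})$ is non-compactly causal (with respect to $\theta|_{\mathfrak j}$). (ii) If $\tau(G)\subseteq G$, then $\tau|_G$ satisfies $\tau\circ\tau=\mathrm{id}$, $d\tau(\mathbf 1)$ restricts to an involution of $\mathfrak g$, and $G/G^\tau$ is non-compactly causal, i.e. $(\mathfrak g,\tau)$ is non-compactly causal in the sense of (i). The orbit $G(z')$ is contained in $\partial_d\Xi$. If moreover $G_{\mathbb C}^\theta=K_{\mathbb C}$ (which is automatic when $G_{\mathbb C}$ is simply connected), then there is a $G$-equivariant homeomorphism $G/G^\tau\to G(z')$ mapping the base point to $z'$. -/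

import Mathlib

open scoped Real

/-! ### Lie algebras with involutions -/

section LieAlgebras

variable {L : Type*} [LieRing L] [LieAlgebra ℝ L]

/-- An involution of a real Lie algebra: an automorphism of order two. -/
def IsLieInvolution (τ : L →ₗ⁅ℝ⁆ L) : Prop :=
  (∀ X, τ (τ X) = X) ∧ τ ≠ LieHom.id

/-- A Cartan involution: `θ ∘ θ = id` and `-κ(X, θ X)` is positive definite, where `κ` is the
Killing form. (On a compact semisimple Lie algebra it is the identity.) -/
def IsCartanInvolution (θ : L →ₗ⁅ℝ⁆ L) : Prop :=
  (∀ X, θ (θ X) = X) ∧ ∀ X, X ≠ 0 → killingForm ℝ L X (θ X) < 0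

/-- The symmetric Lie algebra `(L, τ)` is irreducible: its only `τ`-invariant ideals are `0`
and `L`. -/
def IsIrreducibleSymmetric (τ : L →ₗ⁅ℝ⁆ L) : Prop :=
  ∀ J : LieIdeal ℝ L, (∀ X ∈ J, τ X ∈ J) → J = ⊥ ∨ J = ⊤

/-- `(L, τ)` is a non-compactly causal symmetric Lie algebra, with respect to the Cartan
involution `θ` commuting with `τ`. Write `L = 𝔥 + 𝔮` for the `τ`-eigenspaces to `1`, `-1` and
`L = 𝔨 + 𝔭` for those of `θ`. Then `(L, τ)` is an irreducible semisimple symmetric Lie algebra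
and there is `0 ≠ Y₀ ∈ 𝔮 ∩ 𝔭` which is fixed under (centralized by) `𝔥 ∩ 𝔨`. -/
def IsNonCompactlyCausal (θ τ : L →ₗ⁅ℝ⁆ L) : Prop :=
  LieAlgebra.IsSemisimple ℝ L ∧ IsCartanInvolution θ ∧ IsLieInvolution τ ∧
  (∀ X, θ (τ X) = τ (θ X)) ∧ IsIrreducibleSymmetric τ ∧
  ∃ Y₀ : L, Y₀ ≠ 0 ∧ τ Y₀ = -Y₀ ∧ θ Y₀ = -Y₀ ∧ ∀ X, τ X = X → θ X = X → ⁅X, Y₀⁆ = 0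

/-- Every simple ideal `J` of `L` that is not compact (that is, on which `θ` is not the identity)
is stable under `θ` and `τ`, and `(J, τ|_J)` is non-compactly causal. -/
def HasNonCompactlyCausalComponents (θ τ : L →ₗ⁅ℝ⁆ L) : Prop :=
  ∀ J : LieIdeal ℝ L, IsAtom J → (∃ X ∈ J, θ X ≠ X) →
    ∃ θJ τJ : J →ₗ⁅ℝ⁆ J, (∀ X : J, (θJ X : L) = θ X) ∧ (∀ X : J, (τJ X : L) = τ X) ∧
      IsNonCompactlyCausal θJ τJ

/-- `𝔞` is a maximal abelian subspace of `𝔭`, the `-1`-eigenspace of `θ`. -/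
def IsMaximalAbelianInP (θ : L →ₗ⁅ℝ⁆ L) (𝔞 : Submodule ℝ L) : Prop :=
  Maximal (fun 𝔟 : Submodule ℝ L =>
    (∀ X ∈ 𝔟, θ X = -X) ∧ ∀ X ∈ 𝔟, ∀ X' ∈ 𝔟, ⁅X, X'⁆ = 0) 𝔞

/-- The set `Σ(L, 𝔞)` of restricted roots. -/
def restrictedRoots (𝔞 : Submodule ℝ L) : Set (Module.Dual ℝ 𝔞) :=
  {α | α ≠ 0 ∧ ∃ X : L, X ≠ 0 ∧ ∀ H : 𝔞, ⁅(H : L), X⁆ = α H • X}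

/-- The polyhedral domain `Ω = {X ∈ 𝔞 : |α(X)| < π/2 for all restricted roots α}`. -/
def crownOmega (𝔞 : Submodule ℝ L) : Set 𝔞 :=
  {X | ∀ α ∈ restrictedRoots 𝔞, |α X| < π / 2}

/-- `∂ₑΩ`, the set of extreme points of the closure of `Ω` in `𝔞`. -/
def extremeOmega [TopologicalSpace L] (𝔞 : Submodule ℝ L) : Set 𝔞 :=
  Set.extremePoints ℝ (closure (crownOmega 𝔞))

end LieAlgebras

/-! ### Matrix groups -/

-- Matrices form a Lie ring under the commutator bracket `⁅X, Y⁆ = X * Y - Y * X`.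
attribute [local instance 100] LieRing.ofAssociativeRing

section MatrixGroups

variable {n : Type*} [Fintype n] [DecidableEq n]

/-- The exponential map `𝔤𝔩(n, ℂ) → GL(n, ℂ)`. -/
noncomputable def glExp (X : Matrix n n ℂ) : (Matrix n n ℂ)ˣ := (Matrix.isUnit_exp X).unit

/-- The (underlying set of the) Lie algebra of a closed subgroup `S` of `GL(n, ℂ)`. -/
def lieSet (S : Subgroup (Matrix n n ℂ)ˣ) : Set (Matrix n n ℂ) :=
  {X | ∀ t : ℝ, glExp (t • X) ∈ S}

end MatrixGroups

/-- A semisimple Lie group `G` with a complexification `G_ℂ`, a Cartan involution and a maximal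
abelian subspace `𝔞 ⊆ 𝔭`. The group `G_ℂ` is realized as a closed subgroup of `GL(n, ℂ)`; every
complex semisimple Lie group has such a realization. `G_ℂ` may be the universal complexification of
`G` or any other one to which the Cartan involution extends. -/
structure CrownSetting (n : Type*) [Fintype n] [DecidableEq n] where
  /-- the complex group `G_ℂ` -/
  GC : Subgroup (Matrix n n ℂ)ˣ
  isClosed_GC : IsClosed (GC : Set (Matrix n n ℂ)ˣ)
  /-- the semisimple Lie group `G` inside `G_ℂ` -/
  G : Subgroup GC
  isClosed_G : IsClosed (G : Set GC)
  /-- the Lie algebra of `G` -/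
  g : LieSubalgebra ℝ (Matrix n n ℂ)
  coe_g : (g : Set (Matrix n n ℂ)) = lieSet (G.map GC.subtype)
  isSemisimple_g : LieAlgebra.IsSemisimple ℝ g
  /-- `Lie(G_ℂ) = 𝔤 + i𝔤` -/
  lieSet_GC : lieSet GC = {X | ∃ A B : g, X = (A : Matrix n n ℂ) + Complex.I • (B : Matrix n n ℂ)}
  /-- `𝔤 ∩ i𝔤 = 0` -/
  real_form : ∀ X ∈ g, Complex.I • X ∈ g → X = 0
  /-- the Cartan involution on `𝔤` -/
  θ : g →ₗ⁅ℝ⁆ g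
  isCartan : IsCartanInvolution θ
  /-- the holomorphic extension of the Cartan involution from `G` to `G_ℂ` -/
  Θ : GC →* GC
  continuous_Θ : Continuous Θ
  Θ_Θ : ∀ u, Θ (Θ u) = u
  /-- `Θ` is holomorphic, and its differential is the complex-linear extension of `θ` -/
  Θ_exp : ∀ (A B : g) (u v : GC),
    (u : (Matrix n n ℂ)ˣ) = glExp ((A : Matrix n n ℂ) + Complex.I • (B : Matrix n n ℂ)) →
    (v : (Matrix n n ℂ)ˣ) = glExp ((θ A : Matrix n n ℂ) + Complex.I • (θ B : Matrix n n ℂ)) →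
    Θ u = v
  Θ_mem : ∀ u ∈ G, Θ u ∈ G
  /-- the fixed point group `K = G^θ` is a maximal compact subgroup of `G` -/
  maximal_K : Maximal (fun K' : Subgroup GC => K' ≤ G ∧ IsCompact (K' : Set GC))
    (G ⊓ Θ.eqLocus (MonoidHom.id GC))
  /-- a maximal abelian subspace `𝔞` of `𝔭` -/
  𝔞 : Submodule ℝ g
  maximal_𝔞 : IsMaximalAbelianInP θ 𝔞

namespace CrownSetting

variable {n : Type*} [Fintype n] [DecidableEq n] (S : CrownSetting n)

theorem glExp_mem (A B : S.g) :
    glExp ((A : Matrix n n ℂ) + Complex.I • (B : Matrix n n ℂ)) ∈ S.GC := by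
  have h : (A : Matrix n n ℂ) + Complex.I • (B : Matrix n n ℂ) ∈ lieSet S.GC := by
    rw [S.lieSet_GC]; exact ⟨A, B, rfl⟩
  simpa using h 1

/-- The exponential map of `G_ℂ`: `S.expC A B = exp (A + iB)` for `A, B ∈ 𝔤`. -/
noncomputable def expC (A B : S.g) : S.GC := ⟨_, S.glExp_mem A B⟩

/-- The maximal compact subgroup `K = G^θ` of `G`. -/
def K : Subgroup S.GC := S.G ⊓ S.Θ.eqLocus (MonoidHom.id S.GC)

/-- The complexification `K_ℂ` of `K` in `G_ℂ`: the subgroup generated by `K` and `exp (i𝔨)`,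
`𝔨` the Lie algebra of `K`. -/
def KC : Subgroup S.GC :=
  Subgroup.closure ((S.K : Set S.GC) ∪ {u | ∃ X : S.g, S.θ X = X ∧ u = S.expC 0 X})

/-- The fixed point group `G_ℂ^θ`. -/
def fixedGC : Subgroup S.GC := S.Θ.eqLocus (MonoidHom.id S.GC)

/-- `z = exp (iY)`. -/
noncomputable def z (Y : S.𝔞) : S.GC := S.expC 0 (Y : S.g)

/-- The point `z' = z K_ℂ` of `G_ℂ / K_ℂ`. -/
noncomputable def z' (Y : S.𝔞) : S.GC ⧸ S.KC := QuotientGroup.mk (S.z Y)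

/-- The distinguished boundary `∂_dΞ = G exp (i ∂ₑΩ) K_ℂ / K_ℂ` of the complex crown. -/
def distinguishedBoundary : Set (S.GC ⧸ S.KC) :=
  {x | ∃ u : S.G, ∃ Y ∈ extremeOmega S.𝔞, x = u • S.z' Y}

/-- The automorphism `τ(u) = z² θ(u) z⁻²` of `G_ℂ`. -/
noncomputable def tau (Y : S.𝔞) : S.GC →* S.GC :=
  (MulAut.conj (S.z Y ^ 2)).toMonoidHom.comp S.Θ

/-- The differential `dτ(1)` on `𝔤`: `dτ(1) X = d/dt τ(exp (tX))` at `t = 0`. -/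
noncomputable def dtau (Y : S.𝔞) (X : S.g) : Matrix n n ℂ :=
  deriv (fun t : ℝ => (((S.tau Y (S.expC (t • X) 0) : S.GC) : (Matrix n n ℂ)ˣ) : Matrix n n ℂ)) 0

/-- `dτ(1)` restricts to an involution `τ` of the Lie algebra `𝔤` such that `(𝔤, τ)` is
non-compactly causal if `𝔤` is simple, and in general the non-compact simple ideals of `𝔤`
with the restriction of `τ` are non-compactly causal. -/
def TauNonCompactlyCausal (Y : S.𝔞) : Prop :=
  ∃ τ : S.g →ₗ⁅ℝ⁆ S.g, (∀ X, (τ X : Matrix n n ℂ) = S.dtau Y X) ∧ IsLieInvolution τ ∧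
    (LieAlgebra.IsSimple ℝ S.g → IsNonCompactlyCausal S.θ τ) ∧
    HasNonCompactlyCausalComponents S.θ τ

/-- The fixed point group `G^τ`, as a subgroup of `G`. -/
noncomputable def Gtau (Y : S.𝔞) : Subgroup S.G :=
  ((S.tau Y).comp S.G.subtype).eqLocus S.G.subtype

end CrownSetting

/-! ### Cartan involutions, restricted weights and extreme points of `Ω` -/

section CartanInvolution

variable {L : Type*} [LieRing L] [LieAlgebra ℝ L]

/-! The operators `ad H`, `H ∈ 𝔞`, commute and are symmetric for the inner product `-κ(X, θ X')`, so
`𝔤` is spanned by joint weight vectors. Since `z² = exp (2iY)`, `Ad(z²)` multiplies a vector of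
weight `α` by `e^{2iα(Y)}`, and `dτ = Ad(z²) ∘ θ`. If `dτ` preserves `𝔤`, then `𝔤 ∩ i𝔤 = 0` forces
`sin (2α(Y)) = 0`; as `|α(Y)| ≤ π/2` on the closure of `Ω`, `α(Y)` is `0` or `±π/2`. Hence `(ad Y)³
= (π/2)² ad Y` and `Ad(z²) = 1 - (8/π²)(ad Y)²` on `𝔤` (`cubic_and_dtau_of_dtau_mem`).

Part (i) is algebra with these two identities. They give the spectrum, `τ² = 1` and `τθ = θτ`. The
causal element is `Y` itself: if `X` is fixed by `τ` and `θ`, then `(ad Y)² X = 0`, so `[Y, X] = 0`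
by symmetry of `ad Y`. In a simple ideal the component of `Y` plays this role. It is non-zero in a
noncompact one, because otherwise `Y` could be moved inside the closure of `Ω` along that ideal,
against extremality (`component_ne_zero_of_mem_extremeOmega`).

For (ii), `τ(G) ⊆ G` gives `dτ(𝔤) ⊆ 𝔤`, and `Θ(z) = z⁻¹` identifies the stabilizer of `z'` with
`G^τ` when `K_ℂ = G_ℂ^θ`. It remains to see that the orbit map is open. The map `u K_ℂ ↦ u Θ(u)⁻¹`,
followed by right translation by `z⁻²`, sends `u z'` to `w = u τ(u)⁻¹`, and `τ(w) = w⁻¹`. If `u z'`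
is near `z'`, then `w = exp X` with `X ∈ 𝔤` small and `dτ X = -X`, so `v = exp (X/2)` satisfies `v
τ(v)⁻¹ = w`, whence `v z' = u z'` with `v` near `1`. -/

theorem IsCartanInvolution.killingForm_map {θ : L →ₗ⁅ℝ⁆ L} (hθ : IsCartanInvolution θ) (X X' : L) :
    killingForm ℝ L (θ X) (θ X') = killingForm ℝ L X X' := by
  let e : L ≃ₗ⁅ℝ⁆ L := { θ with invFun := θ, left_inv := hθ.1, right_inv := hθ.1 }
  exact LieAlgebra.killingForm_of_equiv_apply e X X'

theorem IsCartanInvolution.killingForm_map_right {θ : L →ₗ⁅ℝ⁆ L} (hθ : IsCartanInvolution θ)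
    (X X' : L) : killingForm ℝ L X (θ X') = killingForm ℝ L (θ X) X' := by
  rw [← hθ.killingForm_map, hθ.1]

/-- The adjoint action of an element of `𝔭` is symmetric for the form `κ(X, θ X')`. -/
theorem killingForm_lie_of_map_eq_neg {θ : L →ₗ⁅ℝ⁆ L} {H : L} (hH : θ H = -H) (X X' : L) :
    killingForm ℝ L ⁅H, X⁆ (θ X') = killingForm ℝ L X (θ ⁅H, X'⁆) := by
  rw [LieModule.traceForm_apply_lie_apply', LieHom.map_lie, hH, neg_lie, map_neg]

/-- The inner product `-κ(X, θ X')`. -/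
@[reducible]
noncomputable def IsCartanInvolution.core {θ : L →ₗ⁅ℝ⁆ L} (hθ : IsCartanInvolution θ) :
    InnerProductSpace.Core ℝ L where
  inner X X' := -killingForm ℝ L X (θ X')
  conj_inner_symm X X' := by
    simp only [conj_trivial]
    rw [hθ.killingForm_map_right, LieModule.traceForm_comm]
  re_inner_nonneg X := by
    rcases eq_or_ne X 0 with rfl | h
    · simp
    · simpa using (hθ.2 X h).le
  add_left X X' Z := by simp; ring
  smul_left X X' r := by simp
  definite X h := by
    by_contra h0
    have := hθ.2 X h0
    simp only [neg_eq_zero] at h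
    linarith

/-- A commuting family of operators that are symmetric for the form `κ(X, θ X')` is simultaneously
diagonalizable. -/
theorem IsCartanInvolution.iSup_iInf_eigenspace [Module.Finite ℝ L] {θ : L →ₗ⁅ℝ⁆ L}
    (hθ : IsCartanInvolution θ) {ι : Type*} (f : ι → Module.End ℝ L)
    (hf : ∀ i X X', killingForm ℝ L (f i X) (θ X') = killingForm ℝ L X (θ (f i X')))
    (hc : ∀ i j, Commute (f i) (f j)) :
    ⨆ χ : ι → ℝ, ⨅ i, (f i).eigenspace (χ i) = ⊤ := by
  let c := hθ.core
  let _ : NormedAddCommGroup L := c.toNormedAddCommGroup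
  let _ : InnerProductSpace ℝ L := InnerProductSpace.ofCore c.toCore
  refine LinearMap.IsSymmetric.iSup_iInf_eq_top_of_commute (T := f) (fun i X X' => ?_)
    (fun i j _ => hc i j)
  exact congrArg Neg.neg (hf i X X')

theorem IsCartanInvolution.eq_zero_of_lie_eq_zero {θ : L →ₗ⁅ℝ⁆ L} (hθ : IsCartanInvolution θ)
    {X : L} (hX : ∀ X' : L, ⁅X, X'⁆ = 0) : X = 0 := by
  by_contra h
  have h1 := hθ.2 X h
  have h2 : LieAlgebra.ad ℝ L X = 0 := by ext X'; simpa using hX X'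
  rw [killingForm_apply_apply, h2] at h1
  simp at h1

/-- A symmetric operator and its square have the same kernel; here the operator is `ad H`. -/
theorem IsCartanInvolution.lie_eq_zero_of_lie_lie {θ : L →ₗ⁅ℝ⁆ L} (hθ : IsCartanInvolution θ)
    {H X : L} (hH : θ H = -H) (h : ⁅H, ⁅H, X⁆⁆ = 0) : ⁅H, X⁆ = 0 := by
  by_contra h0
  have := hθ.2 _ h0
  rw [← killingForm_lie_of_map_eq_neg hH, h] at this
  simp at this

/-- An ideal that is an atom is stable under a Cartan involution. -/
theorem IsCartanInvolution.map_mem_of_isAtom {θ : L →ₗ⁅ℝ⁆ L} (hθ : IsCartanInvolution θ)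
    {J : LieIdeal ℝ L} (hJ : IsAtom J) {X : L} (hX : X ∈ J) : θ X ∈ J := by
  rcases hJ.le_iff.1 (inf_le_left : J ⊓ J.comap θ ≤ J) with h | h
  · exfalso
    obtain ⟨Z, hZ, hZ0⟩ : ∃ Z ∈ J, Z ≠ 0 := by
      by_contra! h0
      exact hJ.1 ((LieSubmodule.eq_bot_iff J).2 h0)
    have h1 := hθ.2 Z hZ0
    -- The composite takes values in `J ∩ θJ = 0`, so `κ(Z, θ Z) = 0`, against definiteness.
    have h2 : LieAlgebra.ad ℝ L Z ∘ₗ LieAlgebra.ad ℝ L (θ Z) = 0 := by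
      ext W
      have : ⁅Z, ⁅θ Z, W⁆⁆ ∈ J ⊓ J.comap θ := by
        refine ⟨lie_mem_left ℝ L J _ _ hZ, ?_⟩
        change _ ∈ J.comap θ
        rw [LieIdeal.mem_comap, LieHom.map_lie, LieHom.map_lie, hθ.1]
        exact lie_mem_right ℝ L J _ _ (lie_mem_left ℝ L J _ _ hZ)
      rw [h] at this
      simpa using this
    rw [killingForm_apply_apply, h2] at h1
    simp at h1
  · have : X ∈ J ⊓ J.comap θ := by rwa [h]
    exact LieIdeal.mem_comap.1 this.2

theorem IsMaximalAbelianInP.mem {θ : L →ₗ⁅ℝ⁆ L} {𝔞 : Submodule ℝ L}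
    (h𝔞 : IsMaximalAbelianInP θ 𝔞) {V : L} (hV : θ V = -V) (hc : ∀ H ∈ 𝔞, ⁅V, H⁆ = 0) :
    V ∈ 𝔞 := by
  obtain ⟨⟨h1, h2⟩, h3⟩ := h𝔞
  have key : 𝔞 ⊔ Submodule.span ℝ {V} ≤ 𝔞 := by
    refine h3 ⟨?_, ?_⟩ le_sup_left
    · intro X hX
      obtain ⟨A, hA, B, hB, rfl⟩ := Submodule.mem_sup.1 hX
      obtain ⟨c, rfl⟩ := Submodule.mem_span_singleton.1 hB
      rw [map_add, map_smul, h1 A hA, hV]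
      module
    · intro X hX X' hX'
      obtain ⟨A, hA, B, hB, rfl⟩ := Submodule.mem_sup.1 hX
      obtain ⟨c, rfl⟩ := Submodule.mem_span_singleton.1 hB
      obtain ⟨A', hA', B', hB', rfl⟩ := Submodule.mem_sup.1 hX'
      obtain ⟨c', rfl⟩ := Submodule.mem_span_singleton.1 hB'
      have h4 : ⁅A, V⁆ = 0 := by rw [← lie_skew, hc A hA, neg_zero]
      simp [h2 A hA A' hA', hc A' hA', h4]
  exact key (Submodule.mem_sup_right (Submodule.mem_span_singleton_self V))

/-- `𝔤` is spanned by elements on which `𝔞` acts by a linear form. -/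
theorem IsMaximalAbelianInP.span_weightVectors [Module.Finite ℝ L] {θ : L →ₗ⁅ℝ⁆ L}
    (hθ : IsCartanInvolution θ) {𝔞 : Submodule ℝ L} (h𝔞 : IsMaximalAbelianInP θ 𝔞) :
    Submodule.span ℝ {X : L | ∃ α : Module.Dual ℝ 𝔞, ∀ H : 𝔞, ⁅(H : L), X⁆ = α H • X} = ⊤ := by
  have h := hθ.iSup_iInf_eigenspace (fun H : 𝔞 => LieAlgebra.ad ℝ L (H : L))
    (fun H X X' => by
      simpa using killingForm_lie_of_map_eq_neg (h𝔞.1.1 H H.2) X X')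
    (fun H H' => by
      rw [commute_iff_lie_eq, ← LieHom.map_lie, h𝔞.1.2 H H.2 H' H'.2, map_zero])
  rw [eq_top_iff, ← h]
  refine iSup_le fun χ X hX => ?_
  rcases eq_or_ne X 0 with rfl | hX0
  · simp
  have hX' : ∀ H : 𝔞, ⁅(H : L), X⁆ = χ H • X := fun H => by
    simpa using (Submodule.mem_iInf _).1 hX H
  -- The eigenvalue function `χ` is linear because `X ≠ 0` determines it.
  refine Submodule.subset_span ⟨{ toFun := χ, map_add' := ?_, map_smul' := ?_ }, hX'⟩
  · intro H H'
    refine smul_left_injective ℝ hX0 ?_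
    simp only [add_smul]
    rw [← hX', ← hX', ← hX', Submodule.coe_add, add_lie]
  · intro r H
    refine smul_left_injective ℝ hX0 ?_
    simp only [smul_eq_mul, RingHom.id_apply, mul_smul]
    rw [← hX', ← hX', Submodule.coe_smul, smul_lie]

/-- The values of the restricted roots at a given point are bounded. -/
theorem exists_bound_restrictedRoots [Module.Finite ℝ L] (𝔞 : Submodule ℝ L) (H : 𝔞) :
    ∃ C > 0, ∀ α ∈ restrictedRoots 𝔞, |α H| ≤ C := by
  have hfin := Module.End.finite_hasEigenvalue (LieAlgebra.ad ℝ L (H : L))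
  obtain ⟨C, hC⟩ := (hfin.image fun x => |x|).bddAbove
  refine ⟨max C 1, by positivity, fun α hα => (hC ⟨α H, ?_, rfl⟩).trans (le_max_left _ _)⟩
  obtain ⟨-, X, hX0, hX⟩ := hα
  exact Module.End.hasEigenvalue_of_hasEigenvector
    ⟨Module.End.mem_eigenspace_iff.2 (by simpa using hX H), hX0⟩

section Topology

variable [TopologicalSpace L] [IsTopologicalAddGroup L] [ContinuousSMul ℝ L] [T2Space L]

/-- `Ω` is star-shaped about `0`: shrinking a point with `|α| ≤ π/2` by a factor `t < 1` makes all
the inequalities strict. -/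
theorem mem_closure_crownOmega [Module.Finite ℝ L] {𝔞 : Submodule ℝ L} {X : 𝔞} :
    X ∈ closure (crownOmega 𝔞) ↔ ∀ α ∈ restrictedRoots 𝔞, |α X| ≤ π / 2 := by
  constructor
  · intro h α hα
    have hc : Continuous fun X : 𝔞 => |α X| := α.continuous_of_finiteDimensional.abs
    exact closure_minimal (fun X hX => (hX α hα).le) (isClosed_le hc continuous_const) h
  · intro h
    have ht : Filter.Tendsto (fun t : ℝ => t • X) (nhdsWithin 1 (Set.Ioo 0 1)) (nhds X) := by
      have : Filter.Tendsto (fun t : ℝ => t • X) (nhds 1) (nhds ((1 : ℝ) • X)) :=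
        (continuous_id.smul continuous_const).tendsto 1
      rw [one_smul] at this
      exact this.mono_left nhdsWithin_le_nhds
    have : (nhdsWithin (1 : ℝ) (Set.Ioo 0 1)).NeBot := by
      rw [← mem_closure_iff_nhdsWithin_neBot, closure_Ioo zero_ne_one]
      exact ⟨zero_le_one, le_rfl⟩
    refine mem_closure_of_tendsto ht (Filter.eventually_of_mem self_mem_nhdsWithin ?_)
    intro t ht α hα
    rw [map_smul, smul_eq_mul, abs_mul, abs_of_pos ht.1]
    have := h α hα
    have hpi := Real.pi_pos
    calc t * |α X| ≤ t * (π / 2) := mul_le_mul_of_nonneg_left this ht.1.le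
      _ < 1 * (π / 2) := mul_lt_mul_of_pos_right ht.2 (by positivity)
      _ = π / 2 := one_mul _

/-- At an extreme point `Y`, there is no direction `H ≠ 0` that is invisible to all the restricted
roots that do not vanish at `Y`. -/
theorem eq_zero_of_mem_extremeOmega [Module.Finite ℝ L] {𝔞 : Submodule ℝ L} {Y : 𝔞}
    (hY : Y ∈ extremeOmega 𝔞) {H : 𝔞}
    (hH : ∀ α ∈ restrictedRoots 𝔞, α H = 0 ∨ α Y = 0) : H = 0 := by
  obtain ⟨C, hC0, hC⟩ := exists_bound_restrictedRoots 𝔞 H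
  have hpi := Real.pi_pos
  -- With this size of step, a root vanishing at `Y` stays bounded by `π/2` at `Y ± εH`; the other
  -- roots do not change at all.
  set ε : ℝ := π / 2 / C
  have hε : 0 < ε := by positivity
  have hmem : ∀ s : ℝ, |s| = ε → Y + s • H ∈ closure (crownOmega 𝔞) := by
    intro s hs
    rw [mem_closure_crownOmega]
    intro α hα
    rcases hH α hα with h | h
    · simpa [h] using mem_closure_crownOmega.1 hY.1 α hα
    · rw [map_add, map_smul, h, zero_add, smul_eq_mul, abs_mul, hs]
      calc ε * |α H| ≤ ε * C := mul_le_mul_of_nonneg_left (hC α hα) hε.le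
        _ = π / 2 := div_mul_cancel₀ _ hC0.ne'
  have hseg : Y ∈ openSegment ℝ (Y + ε • H) (Y + (-ε) • H) :=
    ⟨1 / 2, 1 / 2, by norm_num, by norm_num, by norm_num, by module⟩
  have := hY.2 (hmem ε (abs_of_pos hε)) (hmem (-ε) (by rw [abs_neg, abs_of_pos hε])) hseg
  have h2 : ε • H = 0 := by simpa using this
  exact (smul_eq_zero.1 h2).resolve_left hε.ne'

/-- Were `Y = 0`, all roots would vanish at `Y`, extremality would give `𝔞 = 0`, and maximality of
`𝔞` would give `𝔭 = 0`. -/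
theorem ne_zero_of_mem_extremeOmega [Module.Finite ℝ L] {θ : L →ₗ⁅ℝ⁆ L}
    (hθ : IsCartanInvolution θ) {𝔞 : Submodule ℝ L} (h𝔞 : IsMaximalAbelianInP θ 𝔞)
    (hnc : ∃ X, θ X ≠ X) {Y : 𝔞} (hY : Y ∈ extremeOmega 𝔞) : Y ≠ 0 := by
  rintro rfl
  obtain ⟨X, hX⟩ := hnc
  have h0 : ∀ H : 𝔞, H = 0 := fun H =>
    eq_zero_of_mem_extremeOmega hY fun α _ => Or.inr (map_zero α)
  have hmem : X - θ X ∈ 𝔞 := by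
    refine h𝔞.mem (by rw [map_sub, hθ.1]; abel) fun H hH => ?_
    have : H = 0 := congrArg Subtype.val (h0 ⟨H, hH⟩)
    rw [this, lie_zero]
  have : X - θ X = 0 := congrArg Subtype.val (h0 ⟨_, hmem⟩)
  exact hX (sub_eq_zero.1 this).symm

end Topology

end CartanInvolution

/-! ### Simple ideals and the algebraic consequences of the cubic relation -/

section Components

variable {L : Type*} [LieRing L] [LieAlgebra ℝ L]

/-- The restriction of a Lie algebra endomorphism to a stable ideal. -/
def LieHom.restrictIdeal (f : L →ₗ⁅ℝ⁆ L) (J : LieIdeal ℝ L) (h : ∀ X ∈ J, f X ∈ J) :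
    J →ₗ⁅ℝ⁆ J where
  toFun X := ⟨f X, h X X.2⟩
  map_add' X X' := by ext; simp
  map_smul' r X := by ext; simp
  map_lie' := by intro X X'; ext; simp

@[simp]
theorem LieHom.coe_restrictIdeal (f : L →ₗ⁅ℝ⁆ L) (J : LieIdeal ℝ L) (h : ∀ X ∈ J, f X ∈ J)
    (X : J) : (f.restrictIdeal J h X : L) = f X := rfl

theorem IsCartanInvolution.restrictIdeal [Module.Finite ℝ L] {θ : L →ₗ⁅ℝ⁆ L}
    (hθ : IsCartanInvolution θ) (J : LieIdeal ℝ L) (h : ∀ X ∈ J, θ X ∈ J) :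
    IsCartanInvolution (θ.restrictIdeal J h) := by
  refine ⟨fun X => by ext; simp [hθ.1], fun X hX => ?_⟩
  rw [LieIdeal.killingForm_eq]
  exact hθ.2 X (by simpa using hX)

theorem lie_eq_zero_of_mem_of_mem_compl [LieAlgebra.IsSemisimple ℝ L] {J : LieIdeal ℝ L} {X X' : L}
    (hX : X ∈ J) (hX' : X' ∈ Jᶜ) : ⁅X, X'⁆ = 0 := by
  have : ⁅X, X'⁆ ∈ J ⊓ Jᶜ := ⟨lie_mem_left ℝ L J _ _ hX, lie_mem_right ℝ L Jᶜ _ _ hX'⟩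
  rw [inf_compl_eq_bot] at this
  simpa using this

theorem exists_eq_add_of_mem_of_mem_compl [LieAlgebra.IsSemisimple ℝ L] (J : LieIdeal ℝ L) (X : L) :
    ∃ A ∈ J, ∃ B ∈ Jᶜ, X = A + B := by
  have : X ∈ J ⊔ Jᶜ := by rw [sup_compl_eq_top]; simp
  obtain ⟨A, hA, B, hB, h⟩ := (LieSubmodule.mem_sup _ _ _).1 this
  exact ⟨A, hA, B, hB, h.symm⟩

theorem IsCartanInvolution.map_mem_compl [LieAlgebra.IsSemisimple ℝ L] {θ : L →ₗ⁅ℝ⁆ L}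
    (hθ : IsCartanInvolution θ) {J : LieIdeal ℝ L} (hJ : ∀ X ∈ J, θ X ∈ J) {X : L} (hX : X ∈ Jᶜ) :
    θ X ∈ Jᶜ := by
  obtain ⟨A, hA, B, hB, h⟩ := exists_eq_add_of_mem_of_mem_compl J (θ X)
  -- The `J`-component of `θ X` commutes with `Jᶜ`, and also with `J = θJ`; so it is central.
  have hA0 : A = 0 := by
    refine hθ.eq_zero_of_lie_eq_zero fun Z => ?_
    obtain ⟨C, hC, D, hD, rfl⟩ := exists_eq_add_of_mem_of_mem_compl J Z
    have h1 : ⁅θ X, C⁆ = 0 := by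
      rw [← hθ.1 C, ← LieHom.map_lie, ← lie_skew, lie_eq_zero_of_mem_of_mem_compl (hJ C hC) hX]
      simp
    rw [lie_add, lie_eq_zero_of_mem_of_mem_compl hA hD, add_zero]
    rw [h, add_lie, ← lie_skew B, lie_eq_zero_of_mem_of_mem_compl hC hB] at h1
    simpa using h1
  rw [h, hA0, zero_add]
  exact hB

/-- The decomposition of an element of `𝔭` according to a `θ`-stable ideal. -/
theorem IsCartanInvolution.exists_eq_add [LieAlgebra.IsSemisimple ℝ L] {θ : L →ₗ⁅ℝ⁆ L}
    (hθ : IsCartanInvolution θ) {J : LieIdeal ℝ L} (hJ : ∀ X ∈ J, θ X ∈ J) {H : L}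
    (hH : θ H = -H) : ∃ A ∈ J, ∃ B ∈ Jᶜ, H = A + B ∧ θ A = -A := by
  obtain ⟨A, hA, B, hB, rfl⟩ := exists_eq_add_of_mem_of_mem_compl J H
  refine ⟨A, hA, B, hB, rfl, ?_⟩
  have h1 : θ A + A ∈ J := add_mem (hJ A hA) hA
  have h2 : θ A + A ∈ Jᶜ := by
    have : θ A + A = -(θ B + B) := by
      rw [map_add] at hH
      rw [eq_neg_iff_add_eq_zero, ← sub_eq_zero.2 hH]
      abel
    rw [this]
    exact neg_mem (add_mem (hθ.map_mem_compl hJ hB) hB)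
  have : θ A + A ∈ J ⊓ Jᶜ := ⟨h1, h2⟩
  rw [inf_compl_eq_bot] at this
  exact eq_neg_of_add_eq_zero_left (by simpa using this)

section Topology

variable [TopologicalSpace L] [IsTopologicalAddGroup L] [ContinuousSMul ℝ L] [T2Space L]

/-- An extreme point of `Ω` has a non-zero component in every noncompact simple ideal. -/
theorem component_ne_zero_of_mem_extremeOmega [Module.Finite ℝ L] [LieAlgebra.IsSemisimple ℝ L]
    {θ : L →ₗ⁅ℝ⁆ L} (hθ : IsCartanInvolution θ) {𝔞 : Submodule ℝ L}
    (h𝔞 : IsMaximalAbelianInP θ 𝔞) {J : LieIdeal ℝ L} (hJ : ∀ X ∈ J, θ X ∈ J)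
    (hnc : ∃ X ∈ J, θ X ≠ X) {Y : 𝔞} (hY : Y ∈ extremeOmega 𝔞) {A B : L} (hA : A ∈ J)
    (hB : B ∈ Jᶜ) (hAB : (Y : L) = A + B) : A ≠ 0 := by
  rintro rfl
  rw [zero_add] at hAB
  -- A root not vanishing at `H ∈ J` has its root vector in `J`, which commutes with `Y ∈ Jᶜ`; so
  -- that root vanishes at `Y`, as the extremality criterion requires.
  have h0 : ∀ H ∈ 𝔞, H ∈ J → H = 0 := by
    intro H hH hHJ
    have : (⟨H, hH⟩ : 𝔞) = 0 := by
      refine eq_zero_of_mem_extremeOmega hY fun α hα => ?_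
      obtain ⟨-, X, hX0, hX⟩ := hα
      by_cases h : α ⟨H, hH⟩ = 0
      · exact Or.inl h
      · right
        have hXJ : X ∈ J := by
          have h1 : α ⟨H, hH⟩ • X ∈ J := by
            rw [← hX]
            exact lie_mem_left ℝ L J _ _ hHJ
          simpa [smul_smul, inv_mul_cancel₀ h] using J.smul_mem (α ⟨H, hH⟩)⁻¹ h1
        have h2 := hX Y
        rw [hAB, ← lie_skew, lie_eq_zero_of_mem_of_mem_compl hXJ hB, neg_zero] at h2
        exact (smul_eq_zero.1 h2.symm).resolve_right hX0
    exact congrArg Subtype.val this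
  -- By maximality `𝔞` contains the `J`-components of its elements, and these are zero by `h0`. Then
  -- `𝔭 ∩ J` commutes with `𝔞`, so it lies in `𝔞 ∩ J = 0`.
  have hproj : ∀ H ∈ 𝔞, H ∈ Jᶜ := by
    intro H hH
    obtain ⟨C, hC, D, hD, hCD, hθC⟩ := hθ.exists_eq_add hJ (h𝔞.1.1 H hH)
    have hC𝔞 : C ∈ 𝔞 := by
      refine h𝔞.mem hθC fun H' hH' => ?_
      obtain ⟨C', hC', D', hD', hCD', -⟩ := hθ.exists_eq_add hJ (h𝔞.1.1 H' hH')
      have h1 := h𝔞.1.2 H hH H' hH'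
      rw [hCD, hCD', add_lie, lie_add, lie_add, lie_eq_zero_of_mem_of_mem_compl hC hD',
        ← lie_skew D, lie_eq_zero_of_mem_of_mem_compl hC' hD, neg_zero, zero_add, add_zero] at h1
      rw [hCD', lie_add, lie_eq_zero_of_mem_of_mem_compl hC hD', add_zero]
      have h2 : ⁅C, C'⁆ ∈ J ⊓ Jᶜ := by
        refine ⟨lie_mem_left ℝ L J _ _ hC, ?_⟩
        rw [eq_neg_of_add_eq_zero_left h1]
        exact neg_mem (lie_mem_left ℝ L Jᶜ _ _ hD)
      rw [inf_compl_eq_bot] at h2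
      simpa using h2
    rw [hCD, h0 C hC𝔞 hC, zero_add]
    exact hD
  obtain ⟨X, hXJ, hX⟩ := hnc
  have hVJ : X - θ X ∈ J := sub_mem hXJ (hJ X hXJ)
  have hV𝔞 : X - θ X ∈ 𝔞 := h𝔞.mem (by rw [map_sub, hθ.1]; abel) fun H hH =>
    lie_eq_zero_of_mem_of_mem_compl hVJ (hproj H hH)
  exact hX (sub_eq_zero.1 (h0 _ hV𝔞 hVJ)).symm

end Topology

section Tau

variable {θ τ : L →ₗ⁅ℝ⁆ L} {Y : L}

theorem map_lie_lie_of_map_eq_neg (hY : θ Y = -Y) (X : L) :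
    θ ⁅Y, ⁅Y, X⁆⁆ = ⁅Y, ⁅Y, θ X⁆⁆ := by
  rw [LieHom.map_lie, LieHom.map_lie, hY, neg_lie, neg_lie, lie_neg, neg_neg]

/-- `τ = θ - (8 / π²) (ad Y)² θ` squares to the identity if `(ad Y)³ = (π / 2)² ad Y`. -/
theorem tau_tau_of_cubic (hθ : IsCartanInvolution θ) (hY : θ Y = -Y)
    (hcub : ∀ X : L, ⁅Y, ⁅Y, ⁅Y, X⁆⁆⁆ = (π / 2) ^ 2 • ⁅Y, X⁆)
    (hτ : ∀ X, τ X = θ X - (8 / π ^ 2) • ⁅Y, ⁅Y, θ X⁆⁆) (X : L) : τ (τ X) = X := by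
  have hpi := Real.pi_pos.ne'
  rw [hτ (τ X), hτ X]
  simp only [map_sub, map_smul, map_lie_lie_of_map_eq_neg hY, hθ.1, lie_sub, lie_smul, hcub]
  match_scalars
  · ring
  · field_simp
    ring

theorem tau_comm_of_cubic (hY : θ Y = -Y)
    (hτ : ∀ X, τ X = θ X - (8 / π ^ 2) • ⁅Y, ⁅Y, θ X⁆⁆) (X : L) : θ (τ X) = τ (θ X) := by
  rw [hτ, hτ, map_sub, map_smul, map_lie_lie_of_map_eq_neg hY]

theorem lie_eq_zero_of_tau_fixed (hθ : IsCartanInvolution θ) (hY : θ Y = -Y)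
    (hτ : ∀ X, τ X = θ X - (8 / π ^ 2) • ⁅Y, ⁅Y, θ X⁆⁆) {X : L} (h1 : τ X = X) (h2 : θ X = X) :
    ⁅Y, X⁆ = 0 := by
  have hpi := Real.pi_pos.ne'
  refine hθ.lie_eq_zero_of_lie_lie hY ?_
  have h := hτ X
  rw [h1, h2, eq_comm, sub_eq_self] at h
  exact (smul_eq_zero.1 h).resolve_left (by positivity)

theorem tau_eq_neg_of_commute (hτ : ∀ X, τ X = θ X - (8 / π ^ 2) • ⁅Y, ⁅Y, θ X⁆⁆) {A : L}
    (hA : θ A = -A) (hYA : ⁅Y, A⁆ = 0) : τ A = -A := by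
  rw [hτ, hA, lie_neg, hYA]
  simp

theorem isLieInvolution_of_cubic (hθ : IsCartanInvolution θ)
    (hY : θ Y = -Y) (hY0 : Y ≠ 0)
    (hcub : ∀ X : L, ⁅Y, ⁅Y, ⁅Y, X⁆⁆⁆ = (π / 2) ^ 2 • ⁅Y, X⁆)
    (hτ : ∀ X, τ X = θ X - (8 / π ^ 2) • ⁅Y, ⁅Y, θ X⁆⁆) : IsLieInvolution τ := by
  refine ⟨tau_tau_of_cubic hθ hY hcub hτ, fun h => ?_⟩
  have hτY : τ Y = -Y := tau_eq_neg_of_commute hτ hY (lie_self Y)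
  rw [h] at hτY
  have h2 : (2 : ℝ) • Y = 0 := by
    rw [two_smul]
    nth_rewrite 1 [show Y = -Y from hτY]
    exact neg_add_cancel Y
  exact hY0 ((smul_eq_zero.1 h2).resolve_left two_ne_zero)

theorem isNonCompactlyCausal_of_cubic [LieAlgebra.IsSimple ℝ L] (hθ : IsCartanInvolution θ)
    (hY : θ Y = -Y) (hY0 : Y ≠ 0)
    (hcub : ∀ X : L, ⁅Y, ⁅Y, ⁅Y, X⁆⁆⁆ = (π / 2) ^ 2 • ⁅Y, X⁆)
    (hτ : ∀ X, τ X = θ X - (8 / π ^ 2) • ⁅Y, ⁅Y, θ X⁆⁆) : IsNonCompactlyCausal θ τ := by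
  refine ⟨inferInstance, hθ, isLieInvolution_of_cubic hθ hY hY0 hcub hτ, tau_comm_of_cubic hY hτ,
    fun J _ => LieAlgebra.IsSimple.eq_bot_or_eq_top J, Y, hY0,
    tau_eq_neg_of_commute hτ hY (lie_self Y), hY, fun X h1 h2 => ?_⟩
  rw [← lie_skew, lie_eq_zero_of_tau_fixed hθ hY hτ h1 h2, neg_zero]

theorem hasNonCompactlyCausalComponents_of_cubic [Module.Finite ℝ L] [LieAlgebra.IsSemisimple ℝ L]
    [TopologicalSpace L] [IsTopologicalAddGroup L] [ContinuousSMul ℝ L] [T2Space L]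
    (hθ : IsCartanInvolution θ) {𝔞 : Submodule ℝ L} (h𝔞 : IsMaximalAbelianInP θ 𝔞) {Y : 𝔞}
    (hY : Y ∈ extremeOmega 𝔞)
    (hcub : ∀ X : L, ⁅(Y : L), ⁅(Y : L), ⁅(Y : L), X⁆⁆⁆ = (π / 2) ^ 2 • ⁅(Y : L), X⁆)
    (hτ : ∀ X, τ X = θ X - (8 / π ^ 2) • ⁅(Y : L), ⁅(Y : L), θ X⁆⁆) :
    HasNonCompactlyCausalComponents θ τ := by
  intro J hJ hnc
  have hθJ : ∀ X ∈ J, θ X ∈ J := fun X hX => hθ.map_mem_of_isAtom hJ hX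
  have hτJ : ∀ X ∈ J, τ X ∈ J := fun X hX => by
    rw [hτ]
    exact sub_mem (hθJ X hX) (J.smul_mem _
      (lie_mem_right ℝ L J _ _ (lie_mem_right ℝ L J _ _ (hθJ X hX))))
  have hθY : θ (Y : L) = -Y := h𝔞.1.1 Y Y.2
  obtain ⟨A, hA, B, hB, hAB, hθA⟩ := hθ.exists_eq_add hθJ hθY
  have hA0 := component_ne_zero_of_mem_extremeOmega hθ h𝔞 hθJ hnc hY hA hB hAB
  -- On `J` the operators `ad A` and `ad Y` agree, so both identities for `Y` pass to its component
  -- `A`.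
  have hlie : ∀ X ∈ J, ⁅A, X⁆ = ⁅(Y : L), X⁆ := fun X hX => by
    rw [hAB, add_lie, ← lie_skew B, lie_eq_zero_of_mem_of_mem_compl hX hB, neg_zero, add_zero]
  have hsimple := LieAlgebra.IsSemisimple.isSimple_of_isAtom J hJ
  refine ⟨θ.restrictIdeal J hθJ, τ.restrictIdeal J hτJ, fun X => rfl, fun X => rfl, ?_⟩
  refine isNonCompactlyCausal_of_cubic (Y := ⟨A, hA⟩) (hθ.restrictIdeal J hθJ) (Subtype.ext hθA)
    (fun h => hA0 (congrArg Subtype.val h)) (fun X => Subtype.ext ?_) (fun X => Subtype.ext ?_)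
  · have h1 : ∀ X ∈ J, ⁅(Y : L), X⁆ ∈ J := fun X hX => lie_mem_right ℝ L J _ _ hX
    change ⁅A, ⁅A, ⁅A, (X : L)⁆⁆⁆ = (π / 2) ^ 2 • ⁅A, (X : L)⁆
    rw [hlie X X.2, hlie _ (h1 X X.2), hlie _ (h1 _ (h1 X X.2)), hcub]
  · have h1 : ∀ X ∈ J, ⁅(Y : L), X⁆ ∈ J := fun X hX => lie_mem_right ℝ L J _ _ hX
    change τ X = θ X - (8 / π ^ 2) • ⁅A, ⁅A, θ X⁆⁆
    rw [hlie _ (hθJ X X.2), hlie _ (h1 _ (hθJ X X.2)), hτ]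

end Tau

/-! ### The complex spectrum of `ad Y` -/

section Spectrum

/-- The complex spectrum of `ad Y`. -/
theorem spectrum_ad_of_cubic [Module.Finite ℝ L] {θ : L →ₗ⁅ℝ⁆ L} (hθ : IsCartanInvolution θ)
    {Y : L} (hY : θ Y = -Y) (hY0 : Y ≠ 0)
    (hcub : ∀ X : L, ⁅Y, ⁅Y, ⁅Y, X⁆⁆⁆ = (π / 2) ^ 2 • ⁅Y, X⁆) :
    spectrum ℂ ((LieAlgebra.ad ℝ L Y).baseChange ℂ) =
      {-((π / 2 : ℝ) : ℂ), 0, ((π / 2 : ℝ) : ℂ)} := by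
  have hpi := Real.pi_pos
  have hreal : ∀ (μ : ℝ) (X : L), X ≠ 0 → ⁅Y, X⁆ = μ • X →
      (μ : ℂ) ∈ spectrum ℂ ((LieAlgebra.ad ℝ L Y).baseChange ℂ) := by
    intro μ X hX h
    rw [← Module.End.hasEigenvalue_iff_mem_spectrum]
    refine Module.End.hasEigenvalue_of_hasEigenvector (x := (1 : ℂ) ⊗ₜ[ℝ] X)
      ⟨Module.End.mem_eigenspace_iff.2 ?_, ?_⟩
    · rw [LinearMap.baseChange_tmul, LieAlgebra.ad_apply, h, TensorProduct.tmul_smul,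
        TensorProduct.smul_tmul', TensorProduct.smul_tmul']
      simp
    · intro h0
      refine hX (Module.FaithfullyFlat.tensorProduct_mk_injective (A := ℝ) (B := ℂ) L ?_)
      simpa using h0
  obtain ⟨X, hX⟩ : ∃ X : L, ⁅Y, X⁆ ≠ 0 := by
    by_contra! h
    exact hY0 (hθ.eq_zero_of_lie_eq_zero h)
  -- `(ad Y - π/2)(ad Y + π/2)` kills `[Y, X] ≠ 0`, so `[Y, X]` or its image under the second factor
  -- is an eigenvector.
  have hpm : ∃ X' : L, X' ≠ 0 ∧ (⁅Y, X'⁆ = (π / 2) • X' ∨ ⁅Y, X'⁆ = (-(π / 2)) • X') := by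
    by_cases h : ⁅Y, ⁅Y, X⁆⁆ + (π / 2) • ⁅Y, X⁆ = 0
    · exact ⟨⁅Y, X⁆, hX, Or.inr (by rw [neg_smul]; exact eq_neg_of_add_eq_zero_left h)⟩
    · refine ⟨_, h, Or.inl ?_⟩
      rw [lie_add, lie_smul, hcub]
      module
  -- `θ` interchanges the eigenspaces for `π/2` and `-π/2`, since `θ Y = -Y`.
  obtain ⟨P, hP0, hP⟩ : ∃ P : L, P ≠ 0 ∧ ⁅Y, P⁆ = (π / 2) • P := by
    obtain ⟨P, hP0, hP | hP⟩ := hpm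
    · exact ⟨P, hP0, hP⟩
    · refine ⟨θ P, fun h => hP0 (by rw [← hθ.1 P, h, map_zero]), ?_⟩
      rw [← neg_neg ⁅Y, θ P⁆, ← neg_lie, ← hY, ← LieHom.map_lie, hP, map_smul]
      module
  ext μ
  constructor
  · intro hμ
    rw [← Module.End.hasEigenvalue_iff_mem_spectrum] at hμ
    obtain ⟨v, hv, hv0⟩ := hμ.exists_hasEigenvector
    rw [Module.End.mem_eigenspace_iff] at hv
    set T := (LieAlgebra.ad ℝ L Y).baseChange ℂ with hT
    have hT3 : T ∘ₗ T ∘ₗ T = (((π / 2) ^ 2 : ℝ) : ℂ) • T := by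
      have h0 : LieAlgebra.ad ℝ L Y ∘ₗ LieAlgebra.ad ℝ L Y ∘ₗ LieAlgebra.ad ℝ L Y =
          (π / 2) ^ 2 • LieAlgebra.ad ℝ L Y := by
        ext X
        simpa using hcub X
      rw [hT, ← LinearMap.baseChange_comp, ← LinearMap.baseChange_comp, h0,
        LinearMap.baseChange_smul]
      exact LinearMap.ext fun _ => (algebraMap_smul ℂ ((π / 2) ^ 2 : ℝ) _).symm
    have h1 : μ * (μ * μ) = ((π / 2 : ℝ) : ℂ) ^ 2 * μ := by
      have h2 := LinearMap.congr_fun hT3 v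
      simp only [LinearMap.comp_apply, LinearMap.smul_apply, hv, map_smul, smul_smul] at h2
      have := smul_left_injective ℂ hv0 h2
      push_cast at this ⊢
      linear_combination this
    have h2 : (μ + ((π / 2 : ℝ) : ℂ)) * (μ * (μ - ((π / 2 : ℝ) : ℂ))) = 0 := by
      linear_combination h1
    simp only [Set.mem_insert_iff, Set.mem_singleton_iff]
    rcases mul_eq_zero.1 h2 with h | h
    · exact Or.inl (eq_neg_of_add_eq_zero_left h)
    · rcases mul_eq_zero.1 h with h | h
      · exact Or.inr (Or.inl h)
      · exact Or.inr (Or.inr (sub_eq_zero.1 h))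
  · rintro (rfl | rfl | rfl)
    · rw [← Complex.ofReal_neg]
      refine hreal _ (θ P) (fun h => hP0 (by rw [← hθ.1 P, h, map_zero])) ?_
      rw [← neg_neg ⁅Y, θ P⁆, ← neg_lie, ← hY, ← LieHom.map_lie, hP, map_smul]
      module
    · simpa using hreal 0 Y hY0 (by simp)
    · exact hreal _ P hP0 hP

end Spectrum

end Components

/-! ### The matrix exponential and closed subgroups of `GL(n, ℂ)` -/

section MatrixExponential

open Filter Topology

variable {n : Type*} [Fintype n] [DecidableEq n]

@[simp]
theorem coe_glExp (X : Matrix n n ℂ) :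
    ((glExp X : (Matrix n n ℂ)ˣ) : Matrix n n ℂ) = NormedSpace.exp X := rfl

@[simp]
theorem glExp_zero : glExp (0 : Matrix n n ℂ) = 1 := by
  ext1
  simp [NormedSpace.exp_zero]

theorem glExp_add {X X' : Matrix n n ℂ} (h : Commute X X') :
    glExp (X + X') = glExp X * glExp X' :=
  Units.ext (Matrix.exp_add_of_commute X X' h)

theorem glExp_neg (X : Matrix n n ℂ) : glExp (-X) = (glExp X)⁻¹ := by
  rw [eq_inv_iff_mul_eq_one, ← glExp_add (Commute.refl X).neg_left, neg_add_cancel, glExp_zero]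

theorem glExp_zsmul (m : ℤ) (X : Matrix n n ℂ) : glExp (m • X) = glExp X ^ m := by
  have h : ∀ k : ℕ, glExp (k • X) = glExp X ^ k := fun k =>
    Units.ext (by simpa using Matrix.exp_nsmul k X)
  cases m with
  | ofNat k => simpa using h k
  | negSucc k => rw [negSucc_zsmul, glExp_neg, h, zpow_negSucc]

theorem glExp_conj (u : (Matrix n n ℂ)ˣ) (X : Matrix n n ℂ) :
    glExp ((u : Matrix n n ℂ) * X * ((u⁻¹ : (Matrix n n ℂ)ˣ) : Matrix n n ℂ)) =
      u * glExp X * u⁻¹ :=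
  Units.ext (Matrix.exp_units_conj u X)

theorem isEmbedding_unitsVal : IsEmbedding (Units.val : (Matrix n n ℂ)ˣ → Matrix n n ℂ) := by
  open scoped Matrix.Norms.Operator in
  exact (Units.isOpenEmbedding_val (R := Matrix n n ℂ)).isEmbedding

theorem continuous_glExp : Continuous (glExp : Matrix n n ℂ → (Matrix n n ℂ)ˣ) := by
  rw [isEmbedding_unitsVal.continuous_iff]
  open scoped Matrix.Norms.Operator in
  exact (NormedSpace.exp_continuous (𝔸 := Matrix n n ℂ))

/-- `exp X · W = e^μ W · exp X` if `[X, W] = μ W`. -/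
theorem exp_mul_eq_smul_mul_exp {X W : Matrix n n ℂ} {μ : ℂ} (h : X * W - W * X = μ • W) :
    NormedSpace.exp X * W = Complex.exp μ • (W * NormedSpace.exp X) := by
  -- The relation reads `W (X + μ) = X W`, and intertwining passes to exponentials.
  have h1 : SemiconjBy W (X + μ • (1 : Matrix n n ℂ)) X := by
    change W * (X + μ • (1 : Matrix n n ℂ)) = X * W
    rw [mul_add, Matrix.mul_smul, mul_one, ← h]
    abel
  have h2 : W * NormedSpace.exp (X + μ • (1 : Matrix n n ℂ)) = NormedSpace.exp X * W := by
    open scoped Matrix.Norms.Operator in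
    exact h1.exp_right
  have h3 : NormedSpace.exp (μ • (1 : Matrix n n ℂ)) = Complex.exp μ • (1 : Matrix n n ℂ) := by
    have := (Matrix.exp_diagonal (fun _ : n => μ))
    rw [Matrix.smul_one_eq_diagonal, this]
    ext i j
    simp [Matrix.diagonal_apply, Matrix.one_apply, Pi.coe_exp, Complex.exp_eq_exp_ℂ]
  rw [← h2, Matrix.exp_add_of_commute _ _ ((Commute.one_right X).smul_right μ), h3]
  simp

theorem deriv_exp_smul_zero (X : Matrix n n ℂ) :
    deriv (fun t : ℝ => NormedSpace.exp (t • X)) 0 = X := by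
  open scoped Matrix.Norms.Operator in
  have h := hasDerivAt_exp_smul_const (𝕂 := ℝ) X (0 : ℝ)
  rw [zero_smul, NormedSpace.exp_zero, one_mul] at h
  exact h.deriv

/-- The exponential map is injective near `0`. -/
theorem exists_nhds_injOn_glExp :
    ∃ U ∈ 𝓝 (0 : Matrix n n ℂ), Set.InjOn (glExp : Matrix n n ℂ → (Matrix n n ℂ)ˣ) U := by
  open scoped Matrix.Norms.Operator in
  have h : HasStrictFDerivAt (NormedSpace.exp : Matrix n n ℂ → Matrix n n ℂ)
      ((ContinuousLinearEquiv.refl ℂ (Matrix n n ℂ) : _ →L[ℂ] Matrix n n ℂ)) 0 :=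
    hasStrictFDerivAt_exp_zero
  refine ⟨_, (h.toOpenPartialHomeomorph _).open_source.mem_nhds
    h.mem_toOpenPartialHomeomorph_source, fun X hX X' hX' hXX' => ?_⟩
  exact (h.toOpenPartialHomeomorph _).injOn hX hX' (congrArg Units.val hXX')

/-- A closed subgroup does not meet the image of a small neighborhood of `0` in a complement of
its Lie algebra, except in `1`. -/
theorem eventually_eq_zero_of_glExp_mem {H : Subgroup (Matrix n n ℂ)ˣ}
    (hH : IsClosed (H : Set (Matrix n n ℂ)ˣ)) {V : Submodule ℝ (Matrix n n ℂ)}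
    (hV : ∀ X ∈ V, X ∈ lieSet H → X = 0) :
    ∀ᶠ X in 𝓝 (0 : Matrix n n ℂ), X ∈ V → glExp X ∈ H → X = 0 := by
  have : FirstCountableTopology (Matrix n n ℂ) :=
    inferInstanceAs (FirstCountableTopology (n → n → ℂ))
  open scoped Matrix.Norms.Operator in
  by_contra hcon
  have hfreq : ∃ᶠ X in 𝓝 (0 : Matrix n n ℂ), X ∈ V ∧ glExp X ∈ H ∧ X ≠ 0 := by
    rw [Filter.not_eventually] at hcon
    exact hcon.mono fun X hX => by push Not at hX; exact hX
  obtain ⟨v, hv0, hv⟩ := exists_seq_forall_of_frequently hfreq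
  have hnorm : ∀ k, ‖v k‖ ≠ 0 := fun k => norm_ne_zero_iff.2 (hv k).2.2
  have hnorm0 : Tendsto (fun k => ‖v k‖) atTop (𝓝 0) := by simpa using hv0.norm
  have : ProperSpace (Matrix n n ℂ) := FiniteDimensional.proper ℝ _
  obtain ⟨w, hw, φ, hφ, hlim⟩ := (isCompact_sphere (0 : Matrix n n ℂ) 1).tendsto_subseq
    (x := fun k => ‖v k‖⁻¹ • v k) (fun k => by
      rw [mem_sphere_zero_iff_norm, norm_smul, norm_inv, norm_norm, inv_mul_cancel₀ (hnorm k)])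
  have hwV : w ∈ V := by
    have hcl : IsClosed (V : Set (Matrix n n ℂ)) := V.closed_of_finiteDimensional
    exact hcl.mem_of_tendsto hlim (Eventually.of_forall fun k => V.smul_mem _ (hv _).1)
  have hwH : w ∈ lieSet H := by
    intro t
    -- The integer multiples `⌊t/‖v‖⌋ v` of the small vectors tend to `t w`; their exponentials are
    -- powers of elements of the closed group `H`.
    have ht : Tendsto (fun k => (⌊t / ‖v (φ k)‖⌋ : ℝ) * ‖v (φ k)‖) atTop (𝓝 t) := by
      have h0 : Tendsto (fun k => ‖v (φ k)‖) atTop (𝓝 0) := hnorm0.comp hφ.tendsto_atTop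
      refine tendsto_of_tendsto_of_tendsto_of_le_of_le (g := fun k => t - ‖v (φ k)‖)
        (h := fun _ => t) (by simpa using tendsto_const_nhds.sub h0) tendsto_const_nhds
        (fun k => ?_) (fun k => ?_)
      · have hp : 0 < ‖v (φ k)‖ := norm_pos_iff.2 (hv _).2.2
        have := mul_le_mul_of_nonneg_right (Int.lt_floor_add_one (t / ‖v (φ k)‖)).le hp.le
        rw [div_mul_cancel₀ _ hp.ne', add_mul, one_mul] at this
        simpa using this
      · have hp : 0 < ‖v (φ k)‖ := norm_pos_iff.2 (hv _).2.2
        have := mul_le_mul_of_nonneg_right (Int.floor_le (t / ‖v (φ k)‖)) hp.le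
        rwa [div_mul_cancel₀ _ hp.ne'] at this
    have hlim2 : Tendsto (fun k => glExp (((⌊t / ‖v (φ k)‖⌋ : ℝ) * ‖v (φ k)‖) •
        (‖v (φ k)‖⁻¹ • v (φ k)))) atTop (𝓝 (glExp (t • w))) :=
      (continuous_glExp.tendsto _).comp (ht.smul hlim)
    refine hH.mem_of_tendsto hlim2 (Eventually.of_forall fun k => ?_)
    have : ((⌊t / ‖v (φ k)‖⌋ : ℝ) * ‖v (φ k)‖) • (‖v (φ k)‖⁻¹ • v (φ k)) =
        ⌊t / ‖v (φ k)‖⌋ • v (φ k) := by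
      rw [smul_smul, mul_assoc, mul_inv_cancel₀ (hnorm _), mul_one, Int.cast_smul_eq_zsmul]
    simp only [this, glExp_zsmul]
    exact H.zpow_mem (hv _).2.1 _
  have := hV w hwV hwH
  rw [mem_sphere_zero_iff_norm, this, norm_zero] at hw
  exact zero_ne_one hw

/-- Cartan's closed subgroup theorem: near `1`, a closed subgroup of `GL(n, ℂ)` consists of
exponentials of small elements of its Lie algebra. -/
theorem eventually_exists_glExp_eq {H : Subgroup (Matrix n n ℂ)ˣ}
    (hH : IsClosed (H : Set (Matrix n n ℂ)ˣ)) {W : Submodule ℝ (Matrix n n ℂ)}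
    (hW : (W : Set (Matrix n n ℂ)) = lieSet H) {U : Set (Matrix n n ℂ)}
    (hU : U ∈ 𝓝 (0 : Matrix n n ℂ)) :
    ∀ᶠ u in 𝓝 (1 : (Matrix n n ℂ)ˣ), u ∈ H → ∃ X ∈ W, X ∈ U ∧ glExp X = u := by
  open scoped Matrix.Norms.Operator in
  obtain ⟨V, hV⟩ := W.exists_isCompl
  have hV0 : ∀ X ∈ V, X ∈ lieSet H → X = 0 := fun X hX hX' => by
    rw [← hW] at hX'
    exact Submodule.disjoint_def.1 hV.disjoint X hX' hX
  let P : Matrix n n ℂ →L[ℝ] Matrix n n ℂ := LinearMap.toContinuousLinearMap (W.projection V hV)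
  let Q : Matrix n n ℂ →L[ℝ] Matrix n n ℂ := LinearMap.toContinuousLinearMap (V.projection W hV.symm)
  have hP : ∀ X, P X ∈ W := fun X => Submodule.projection_apply_mem hV X
  have hQ : ∀ X, Q X ∈ V := fun X => Submodule.projection_apply_mem hV.symm X
  have hPQ : P + Q = ContinuousLinearMap.id ℝ _ := by
    ext1 X
    exact Submodule.projection_add_projection_eq_self hV X
  have hexp : HasStrictFDerivAt (NormedSpace.exp : Matrix n n ℂ → Matrix n n ℂ)
      (1 : Matrix n n ℂ →L[ℝ] Matrix n n ℂ) 0 := hasStrictFDerivAt_exp_zero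
  -- As `P + Q = 1`, `F` has derivative `1` at `0`, so every `u` near `1` factors as `exp (P X) exp
  -- (Q X)`. For `u ∈ H` the second factor lies in `H` too, and is therefore trivial.
  let F : Matrix n n ℂ → Matrix n n ℂ := fun X => NormedSpace.exp (P X) * NormedSpace.exp (Q X)
  have hF : HasStrictFDerivAt F
      ((ContinuousLinearEquiv.refl ℝ (Matrix n n ℂ) : _ →L[ℝ] Matrix n n ℂ)) 0 := by
    have h1 : HasStrictFDerivAt (fun X => NormedSpace.exp (P X)) P 0 := by
      have := HasStrictFDerivAt.comp (f := P) (0 : Matrix n n ℂ)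
        (by rw [map_zero]; exact hexp) P.hasStrictFDerivAt
      exact this
    have h2 : HasStrictFDerivAt (fun X => NormedSpace.exp (Q X)) Q 0 := by
      have := HasStrictFDerivAt.comp (f := Q) (0 : Matrix n n ℂ)
        (by rw [map_zero]; exact hexp) Q.hasStrictFDerivAt
      exact this
    refine (h1.mul' h2).congr_fderiv ?_
    ext1 X
    simp only [map_zero, NormedSpace.exp_zero]
    rw [add_comm]
    exact (congrArg₂ (· + ·) (mul_one (P X)) (one_mul (Q X))).trans (DFunLike.congr_fun hPQ X)
  have hF0 : F 0 = ((1 : (Matrix n n ℂ)ˣ) : Matrix n n ℂ) := by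
    simp [F, NormedSpace.exp_zero]
  have hmap := hF.map_nhds_eq_of_equiv
  have hP0 : Tendsto P (𝓝 0) (𝓝 0) := by simpa using P.continuous.tendsto 0
  have hQ0 : Tendsto Q (𝓝 0) (𝓝 0) := by simpa using Q.continuous.tendsto 0
  have hN := (hP0.eventually hU).and (hQ0.eventually (eventually_eq_zero_of_glExp_mem hH hV0))
  have himg := image_mem_map (m := F) hN
  replace himg := hmap.ge himg
  rw [hF0] at himg
  filter_upwards [Units.continuous_val.continuousAt.preimage_mem_nhds himg] with u hu huH
  obtain ⟨X, ⟨hXU, hXQ⟩, hXu⟩ := hu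
  have hXu' : glExp (P X) * glExp (Q X) = u := Units.ext hXu
  have hPH : glExp (P X) ∈ H := by
    have : P X ∈ lieSet H := by rw [← hW]; exact hP X
    simpa using this 1
  have hQH : glExp (Q X) ∈ H := by
    rw [← hXu'] at huH
    exact (H.mul_mem_cancel_left hPH).1 huH
  have hQ1 := hXQ (hQ X) hQH
  exact ⟨P X, hP X, hXU, by rw [← hXu', hQ1, glExp_zero, mul_one]⟩

end MatrixExponential

/-! ### Orbits with an open orbit map -/

section OrbitMap

open Topology

/-- If the orbit map of `x` is open at the identity, the orbit of `x` is homeomorphic to the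
quotient by the stabilizer. -/
theorem exists_homeomorph_orbit {G X : Type*} [Group G] [TopologicalSpace G] [ContinuousMul G]
    [TopologicalSpace X] [MulAction G X] [ContinuousSMul G X] (x : X)
    (h : ∀ U ∈ 𝓝 (1 : G), ∀ᶠ y in 𝓝 x, y ∈ MulAction.orbit G x → ∃ v ∈ U, v • x = y) :
    ∃ Φ : (G ⧸ MulAction.stabilizer G x) ≃ₜ MulAction.orbit G x,
      (∀ (u : G) (y : G ⧸ MulAction.stabilizer G x), Φ (u • y) = u • Φ y) ∧
      (Φ (QuotientGroup.mk 1) : X) = x := by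
  let e := (MulAction.orbitEquivQuotientStabilizer G x).symm
  have hmk : ∀ g : G, (e (QuotientGroup.mk g) : X) = g • x := fun g =>
    MulAction.orbitEquivQuotientStabilizer_symm_apply G x g
  have hsmul : ∀ (u : G) (y : G ⧸ MulAction.stabilizer G x), e (u • y) = u • e y := by
    intro u y
    induction y using QuotientGroup.induction_on with
    | H g =>
      ext1
      rw [MulAction.Quotient.smul_mk, hmk, smul_eq_mul, mul_smul, MulAction.orbit.coe_smul, hmk]
  have hcont : Continuous e := by
    refine Continuous.subtype_mk (Continuous.quotient_lift ?_ _) _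
    fun_prop
  have hone : (e (QuotientGroup.mk 1) : X) = x := by rw [hmk, one_smul]
  -- Translation by `u⁻¹` reduces continuity at `u • x` to the hypothesis at `x`.
  have hinv : ∀ y, ContinuousAt e.symm y := by
    intro y
    obtain ⟨y, u, rfl⟩ := y
    have hu : e.symm ⟨u • x, u, rfl⟩ = QuotientGroup.mk u := by
      rw [Equiv.symm_apply_eq]
      exact Subtype.ext (hmk u).symm
    intro W hW
    have hW' : W ∈ 𝓝 (QuotientGroup.mk u : G ⧸ MulAction.stabilizer G x) := hu ▸ hW
    have hU : {v : G | (QuotientGroup.mk (u * v) : G ⧸ MulAction.stabilizer G x) ∈ W} ∈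
        𝓝 (1 : G) := by
      have hc : Continuous fun v : G =>
          (QuotientGroup.mk (u * v) : G ⧸ MulAction.stabilizer G x) :=
        continuous_quotient_mk'.comp (continuous_const.mul continuous_id)
      refine hc.continuousAt.preimage_mem_nhds ?_
      rwa [mul_one]
    have hc : Continuous fun y : MulAction.orbit G x => u⁻¹ • (y : X) :=
      continuous_subtype_val.const_smul u⁻¹
    have hx : u⁻¹ • u • x = x := inv_smul_smul u x
    have h1 := hc.tendsto ⟨u • x, u, rfl⟩
    simp only [hx] at h1
    have h2 := h1.eventually (h _ hU)
    refine Filter.mem_map.2 (h2.mono fun y hy => ?_)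
    obtain ⟨v, hv, hvy⟩ := hy (by
      obtain ⟨y, w, rfl⟩ := y
      exact ⟨u⁻¹ * w, mul_smul _ _ _⟩)
    have hy' : e.symm y = QuotientGroup.mk (u * v) := by
      rw [Equiv.symm_apply_eq]
      ext1
      rw [hmk, mul_smul, hvy, smul_inv_smul]
    change e.symm y ∈ W
    rw [hy']
    exact hv
  refine ⟨{ e with
    continuous_toFun := hcont
    continuous_invFun := continuous_iff_continuousAt.2 hinv }, hsmul, hone⟩

end OrbitMap

/-! ### The automorphism `τ` and its differential -/

namespace CrownSetting

variable {n : Type*} [Fintype n] [DecidableEq n] (S : CrownSetting n)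

instance : IsTopologicalAddGroup S.g := inferInstanceAs (IsTopologicalAddGroup S.g.toSubmodule)
instance : ContinuousSMul ℝ S.g := inferInstanceAs (ContinuousSMul ℝ S.g.toSubmodule)
instance : Module.Finite ℝ (Matrix n n ℂ) := Module.Finite.trans ℂ _
instance : Module.Finite ℝ S.g := inferInstanceAs (Module.Finite ℝ S.g.toSubmodule)

theorem coe_g_add (A B : S.g) : ((A + B : S.g) : Matrix n n ℂ) = A + B := rfl
theorem coe_g_neg (A : S.g) : ((-A : S.g) : Matrix n n ℂ) = -A := rfl
theorem coe_g_zero : ((0 : S.g) : Matrix n n ℂ) = 0 := rfl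
theorem coe_g_smul (r : ℝ) (A : S.g) : ((r • A : S.g) : Matrix n n ℂ) = r • (A : Matrix n n ℂ) := rfl

instance : ContinuousSMul S.G (S.GC ⧸ S.KC) where
  continuous_smul := by
    have h : Continuous fun p : S.G × (S.GC ⧸ S.KC) => (p.1 : S.GC) • p.2 := by fun_prop
    exact h

/-! ### The automorphism `Θ` and its conjugate `τ` -/

theorem θ_coe (Y : S.𝔞) : S.θ (Y : S.g) = -(Y : S.g) := S.maximal_𝔞.1.1 Y Y.2

theorem coe_expC (A B : S.g) : ((S.expC A B : S.GC) : (Matrix n n ℂ)ˣ) =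
    glExp ((A : Matrix n n ℂ) + Complex.I • (B : Matrix n n ℂ)) := rfl

theorem Θ_expC (A B : S.g) : S.Θ (S.expC A B) = S.expC (S.θ A) (S.θ B) :=
  S.Θ_exp A B _ _ rfl rfl

theorem expC_neg (A B : S.g) : S.expC (-A) (-B) = (S.expC A B)⁻¹ := by
  ext1
  rw [Subgroup.coe_inv, coe_expC, coe_expC, ← glExp_neg]
  congr 1
  simp only [coe_g_neg, smul_neg]
  abel

theorem Θ_z (Y : S.𝔞) : S.Θ (S.z Y) = (S.z Y)⁻¹ := by
  rw [z, Θ_expC, map_zero, θ_coe, ← expC_neg, neg_zero]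

theorem coe_z_sq (Y : S.𝔞) : (((S.z Y) ^ 2 : S.GC) : (Matrix n n ℂ)ˣ) =
    glExp ((2 * Complex.I) • ((Y : S.g) : Matrix n n ℂ)) := by
  rw [Subgroup.coe_pow, z, coe_expC, pow_two, ← glExp_add (Commute.refl _)]
  congr 1
  simp only [coe_g_zero]
  module

theorem tau_apply (Y : S.𝔞) (u : S.GC) : S.tau Y u = S.z Y ^ 2 * S.Θ u * (S.z Y ^ 2)⁻¹ := rfl

theorem tau_tau (Y : S.𝔞) (u : S.GC) : S.tau Y (S.tau Y u) = u := by
  simp only [tau_apply, map_mul, map_inv, map_pow, Θ_z, S.Θ_Θ]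
  group

/-- Conjugation by `z²`. -/
noncomputable def conjZ (Y : S.𝔞) : Matrix n n ℂ →ₗ[ℂ] Matrix n n ℂ where
  toFun X := (((S.z Y ^ 2 : S.GC) : (Matrix n n ℂ)ˣ) : Matrix n n ℂ) * X *
    ((((S.z Y ^ 2 : S.GC) : (Matrix n n ℂ)ˣ)⁻¹ : (Matrix n n ℂ)ˣ) : Matrix n n ℂ)
  map_add' X X' := by rw [mul_add, add_mul]
  map_smul' r X := by simp

theorem conjZ_apply (Y : S.𝔞) (X : Matrix n n ℂ) :
    S.conjZ Y X = (((S.z Y ^ 2 : S.GC) : (Matrix n n ℂ)ˣ) : Matrix n n ℂ) * X *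
      ((((S.z Y ^ 2 : S.GC) : (Matrix n n ℂ)ˣ)⁻¹ : (Matrix n n ℂ)ˣ) : Matrix n n ℂ) := rfl

theorem conjZ_lie (Y : S.𝔞) (X X' : Matrix n n ℂ) :
    S.conjZ Y ⁅X, X'⁆ = ⁅S.conjZ Y X, S.conjZ Y X'⁆ := by
  have h : ∀ X X' : Matrix n n ℂ, S.conjZ Y (X * X') = S.conjZ Y X * S.conjZ Y X' := by
    intro X X'
    simp only [conjZ_apply, mul_assoc, Units.inv_mul_cancel_left]
  rw [Ring.lie_def, Ring.lie_def, map_sub, h, h]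

theorem conjZ_of_lie_eq_smul (Y : S.𝔞) {X : S.g} {a : ℝ} (h : ⁅(Y : S.g), X⁆ = a • X) :
    S.conjZ Y X = Complex.exp (2 * a * Complex.I) • (X : Matrix n n ℂ) := by
  have h1 : ((Y : S.g) : Matrix n n ℂ) * X - X * ((Y : S.g) : Matrix n n ℂ) =
      (a : ℂ) • (X : Matrix n n ℂ) := by
    have := congrArg (Subtype.val : S.g → Matrix n n ℂ) h
    rw [Complex.coe_smul]
    exact this
  have h2 := exp_mul_eq_smul_mul_exp (X := (2 * Complex.I) • ((Y : S.g) : Matrix n n ℂ))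
    (W := X) (μ := 2 * a * Complex.I) (by
      rw [Matrix.smul_mul, Matrix.mul_smul, ← smul_sub, h1, smul_smul]
      congr 1
      ring)
  rw [conjZ_apply, coe_z_sq, coe_glExp, h2, Matrix.smul_mul, ← coe_glExp, Units.mul_inv_cancel_right]

theorem coe_tau_expC (Y : S.𝔞) (X : S.g) :
    ((S.tau Y (S.expC X 0) : S.GC) : (Matrix n n ℂ)ˣ) = glExp (S.conjZ Y (S.θ X)) := by
  rw [tau_apply, Θ_expC, conjZ_apply, glExp_conj, map_zero]
  simp [coe_expC]

/-- `τ` carries `exp (tX)` to the one-parameter group `exp (t Ad(z²) θ X)`. -/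
theorem dtau_eq (Y : S.𝔞) (X : S.g) : S.dtau Y X = S.conjZ Y (S.θ X) := by
  have h : (fun t : ℝ => (((S.tau Y (S.expC (t • X) 0) : S.GC) : (Matrix n n ℂ)ˣ) :
      Matrix n n ℂ)) = fun t : ℝ => NormedSpace.exp (t • S.conjZ Y (S.θ X)) := by
    funext t
    rw [coe_tau_expC, coe_glExp, map_smul, coe_g_smul, LinearMap.map_smul_of_tower]
  rw [dtau, h]
  exact deriv_exp_smul_zero _

/-! ### The differential of `τ` -/

/-- The differential of `τ` as an endomorphism of `𝔤`. -/
noncomputable def tauLie (Y : S.𝔞) (h : ∀ X : S.g, S.dtau Y X ∈ S.g) : S.g →ₗ⁅ℝ⁆ S.g where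
  toFun X := ⟨S.dtau Y X, h X⟩
  map_add' X X' := by ext1; simp [dtau_eq]
  map_smul' r X := by
    ext1
    simp only [dtau_eq, map_smul, coe_g_smul, RingHom.id_apply]
    exact LinearMap.map_smul_of_tower _ _ _
  map_lie' := by
    intro X X'
    ext1
    simp only [dtau_eq, LieHom.map_lie, LieSubalgebra.coe_bracket, conjZ_lie]

/-- In `e^{2ia} X = cos(2a) X + i sin(2a) X` the last term lies in `𝔤 ∩ i𝔤 = 0`. -/
theorem sin_eq_zero_of_dtau_mem (Y : S.𝔞) {X : S.g} (hX0 : X ≠ 0) {a : ℝ}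
    (h : ⁅(Y : S.g), X⁆ = a • X) (hX : S.conjZ Y X ∈ S.g) : Real.sin (2 * a) = 0 := by
  rw [conjZ_of_lie_eq_smul S Y h] at hX
  have h1 : Complex.exp (2 * a * Complex.I) • (X : Matrix n n ℂ) =
      (Real.cos (2 * a) • X : S.g) + Complex.I • ((Real.sin (2 * a) • X : S.g) : Matrix n n ℂ) := by
    rw [Complex.exp_mul_I, add_smul, coe_g_smul, coe_g_smul,
      ← Complex.coe_smul, ← Complex.coe_smul, smul_smul]
    push_cast
    rw [mul_comm Complex.I]
  rw [h1] at hX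
  have h2 := S.real_form _ (Real.sin (2 * a) • X : S.g).2
    ((S.g.add_mem_iff_right (Real.cos (2 * a) • X : S.g).2).1 hX)
  have h3 : Real.sin (2 * a) • X = 0 := Subtype.ext h2
  exact (smul_eq_zero.1 h3).resolve_right hX0

/-- The possible values of a restricted root at `Y`. -/
theorem eq_of_sin_eq_zero {a : ℝ} (h : Real.sin (2 * a) = 0) (ha : |a| ≤ π / 2) :
    a = 0 ∨ a = π / 2 ∨ a = -(π / 2) := by
  have hpi := Real.pi_pos
  obtain ⟨k, hk⟩ := Real.sin_eq_zero_iff.1 h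
  obtain ⟨h1, h2⟩ := abs_le.1 ha
  have hk1 : (k : ℝ) ≤ 1 := by
    by_contra! hlt
    nlinarith
  have hk2 : (-1 : ℝ) ≤ k := by
    by_contra! hlt
    nlinarith
  have hk1' : k ≤ 1 := by exact_mod_cast hk1
  have hk2' : -1 ≤ k := by exact_mod_cast hk2
  obtain rfl | rfl | rfl : k = -1 ∨ k = 0 ∨ k = 1 := by omega
  · push_cast at hk
    right; right; linarith
  · push_cast at hk
    left; linarith
  · push_cast at hk
    right; left; linarith

/-- Both identities are linear in `X`, so they need checking only on weight vectors, where they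
become scalar identities in `α(Y)`. -/
theorem cubic_and_dtau_of_dtau_mem {Y : S.𝔞} (hY : Y ∈ extremeOmega S.𝔞)
    (h : ∀ X : S.g, S.dtau Y X ∈ S.g) (X : S.g) :
    ⁅(Y : S.g), ⁅(Y : S.g), ⁅(Y : S.g), X⁆⁆⁆ = (π / 2) ^ 2 • ⁅(Y : S.g), X⁆ ∧
      S.conjZ Y X = (X - (8 / π ^ 2) • ⁅(Y : S.g), ⁅(Y : S.g), X⁆⁆ : S.g) := by
  have hpi := Real.pi_pos.ne'
  have hX : X ∈ Submodule.span ℝ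
      {X : S.g | ∃ α : Module.Dual ℝ S.𝔞, ∀ H : S.𝔞, ⁅(H : S.g), X⁆ = α H • X} := by
    rw [S.maximal_𝔞.span_weightVectors S.isCartan]
    trivial
  induction hX using Submodule.span_induction with
  | mem X hX =>
    obtain ⟨α, hα⟩ := hX
    rcases eq_or_ne X 0 with rfl | hX0
    · simp
    have hval : α Y = 0 ∨ α Y = π / 2 ∨ α Y = -(π / 2) := by
      rcases eq_or_ne α 0 with rfl | hα0
      · exact Or.inl rfl
      refine eq_of_sin_eq_zero (S.sin_eq_zero_of_dtau_mem Y hX0 (hα Y) ?_)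
        (mem_closure_crownOmega.1 hY.1 α ⟨hα0, X, hX0, hα⟩)
      -- Since `θ² = 1`, applying `dτ` to `θ X` isolates `Ad(z²) X`.
      have := h (S.θ X)
      rwa [dtau_eq, S.isCartan.1] at this
    have hcub : α Y * (α Y * α Y) = (π / 2) ^ 2 * α Y := by
      rcases hval with h | h | h <;> rw [h] <;> ring
    -- The even quadratic `1 - (8/π²) a²` interpolates `e^{2ia}`: value `1` at `a = 0` and `-1` at
    -- `a = ±π/2`.
    have hexp : Complex.exp (2 * α Y * Complex.I) = ((1 - 8 / π ^ 2 * (α Y * α Y) : ℝ) : ℂ) := by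
      rcases hval with h | h | h
      · simp [h]
      · have h1 : (2 * ((π / 2 : ℝ) : ℂ) * Complex.I) = π * Complex.I := by push_cast; ring
        have h2 : (1 - 8 / π ^ 2 * (π / 2 * (π / 2)) : ℝ) = -1 := by field_simp; norm_num
        rw [h, h1, h2, Complex.exp_pi_mul_I]
        simp
      · have h1 : (2 * ((-(π / 2) : ℝ) : ℂ) * Complex.I) = -(π * Complex.I) := by push_cast; ring
        have h2 : (1 - 8 / π ^ 2 * (-(π / 2) * -(π / 2)) : ℝ) = -1 := by field_simp; norm_num
        rw [h, h1, h2, Complex.exp_neg, Complex.exp_pi_mul_I]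
        simp
    constructor
    · simp only [hα, lie_smul, smul_smul]
      rw [← hcub]
      congr 1
      ring
    · rw [S.conjZ_of_lie_eq_smul Y (hα Y), hexp, Complex.coe_smul, ← coe_g_smul]
      congr 1
      simp only [hα, lie_smul, smul_smul]
      module
  | zero => simp
  | add X X' _ _ hX hX' =>
    constructor
    · simp only [lie_add, smul_add, hX.1, hX'.1]
    · rw [coe_g_add, map_add, hX.2, hX'.2, ← coe_g_add]
      congr 1
      simp only [lie_add]
      module
  | smul r X _ hX =>
    constructor
    · simp only [lie_smul, hX.1]
      rw [smul_comm]
    · rw [coe_g_smul, LinearMap.map_smul_of_tower, hX.2, ← coe_g_smul]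
      congr 1
      simp only [lie_smul]
      module

theorem tauLie_apply {Y : S.𝔞} (hY : Y ∈ extremeOmega S.𝔞) (h : ∀ X : S.g, S.dtau Y X ∈ S.g)
    (X : S.g) : S.tauLie Y h X =
      S.θ X - (8 / π ^ 2) • ⁅(Y : S.g), ⁅(Y : S.g), S.θ X⁆⁆ :=
  Subtype.ext ((S.dtau_eq Y X).trans (S.cubic_and_dtau_of_dtau_mem hY h (S.θ X)).2)

theorem tauNonCompactlyCausal (hnc : ∃ X : S.g, S.θ X ≠ X) {Y : S.𝔞}
    (hY : Y ∈ extremeOmega S.𝔞) (h : ∀ X : S.g, S.dtau Y X ∈ S.g) : S.TauNonCompactlyCausal Y := by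
  have := S.isSemisimple_g
  have hcub := fun X => (S.cubic_and_dtau_of_dtau_mem hY h X).1
  have hτ := S.tauLie_apply hY h
  have hY0 : (Y : S.g) ≠ 0 := by
    simpa using ne_zero_of_mem_extremeOmega S.isCartan S.maximal_𝔞 hnc hY
  refine ⟨S.tauLie Y h, fun X => rfl,
    isLieInvolution_of_cubic S.isCartan (S.θ_coe Y) hY0 hcub hτ,
    fun _ => isNonCompactlyCausal_of_cubic S.isCartan (S.θ_coe Y) hY0 hcub hτ,
    hasNonCompactlyCausalComponents_of_cubic S.isCartan S.maximal_𝔞 hY hcub hτ⟩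

end CrownSetting

/-! ### The action of `G` on the orbit of `z'` -/

namespace CrownSetting

open Topology

variable {n : Type*} [Fintype n] [DecidableEq n] (S : CrownSetting n)

theorem mem_map_subtype_iff {u : S.GC} :
    (u : (Matrix n n ℂ)ˣ) ∈ S.G.map S.GC.subtype ↔ u ∈ S.G :=
  Subgroup.mem_map_iff_mem S.GC.subtype_injective

theorem mem_g_iff {X : Matrix n n ℂ} :
    X ∈ S.g ↔ ∀ t : ℝ, glExp (t • X) ∈ S.G.map S.GC.subtype := by
  rw [← SetLike.mem_coe, S.coe_g]
  rfl

theorem coe_expC_zero (X : S.g) : ((S.expC X 0 : S.GC) : (Matrix n n ℂ)ˣ) = glExp X := by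
  rw [coe_expC, coe_g_zero, smul_zero, add_zero]

theorem expC_mem_G (X : S.g) : S.expC X 0 ∈ S.G := by
  rw [← mem_map_subtype_iff, coe_expC_zero]
  simpa using S.mem_g_iff.1 X.2 1

theorem isClosed_map_subtype : IsClosed (S.G.map S.GC.subtype : Set (Matrix n n ℂ)ˣ) := by
  rw [Subgroup.coe_map]
  exact S.isClosed_GC.isClosedEmbedding_subtypeVal.isClosedMap _ S.isClosed_G

/-- If `τ` preserves `G`, then its differential preserves `𝔤`. -/
theorem dtau_mem_of_tau_mem {Y : S.𝔞} (h : ∀ u ∈ S.G, S.tau Y u ∈ S.G) (X : S.g) :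
    S.dtau Y X ∈ S.g := by
  rw [mem_g_iff]
  intro t
  have h1 := S.mem_map_subtype_iff.2 (h _ (S.expC_mem_G (t • X)))
  rwa [coe_tau_expC, map_smul, coe_g_smul, LinearMap.map_smul_of_tower, ← dtau_eq] at h1

theorem continuous_dtau (Y : S.𝔞) : Continuous (S.dtau Y) := by
  have h : S.dtau Y = fun X : S.g => S.conjZ Y (S.θ X) := funext (S.dtau_eq Y)
  rw [h]
  have h1 : Continuous (S.conjZ Y) := by
    have : Continuous fun X : Matrix n n ℂ =>
        (((S.z Y ^ 2 : S.GC) : (Matrix n n ℂ)ˣ) : Matrix n n ℂ) * X *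
        ((((S.z Y ^ 2 : S.GC) : (Matrix n n ℂ)ˣ)⁻¹ : (Matrix n n ℂ)ˣ) : Matrix n n ℂ) := by
      fun_prop
    exact this
  have h2 : Continuous S.θ := (S.θ : S.g →ₗ[ℝ] S.g).continuous_of_finiteDimensional
  exact h1.comp (continuous_subtype_val.comp h2)

/-- Elements `u` of `G` near `1` with `τ(u) = u⁻¹` are of the form `v τ(v)⁻¹` with `v ∈ G`
near `1`. -/
theorem eventually_exists_mul_inv_tau_eq (Y : S.𝔞) {U : Set S.GC} (hU : U ∈ 𝓝 (1 : S.GC)) :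
    ∀ᶠ u in 𝓝 (1 : S.GC), u ∈ S.G → S.tau Y u = u⁻¹ →
      ∃ v ∈ S.G, v ∈ U ∧ v * (S.tau Y v)⁻¹ = u := by
  obtain ⟨U₀, hU₀, hinj⟩ := exists_nhds_injOn_glExp (n := n)
  have hdt0 : S.dtau Y 0 = 0 := by rw [dtau_eq, map_zero, coe_g_zero, map_zero]
  have hneg : {X : Matrix n n ℂ | -X ∈ U₀} ∈ 𝓝 (0 : Matrix n n ℂ) :=
    continuous_neg.continuousAt.preimage_mem_nhds (by rwa [neg_zero])
  have hhalf : Continuous fun X : S.g => S.expC ((1 / 2 : ℝ) • X) 0 := by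
    refine Continuous.subtype_mk (continuous_glExp.comp ?_) _
    exact (continuous_subtype_val.const_smul (1 / 2 : ℝ)).add continuous_const
  have hexp0 : S.expC ((1 / 2 : ℝ) • 0) 0 = 1 := by
    ext1
    rw [coe_expC_zero, smul_zero, coe_g_zero, glExp_zero, Subgroup.coe_one]
  have hN : {X : S.g | S.dtau Y X ∈ U₀ ∧ S.expC ((1 / 2 : ℝ) • X) 0 ∈ U} ∈ 𝓝 (0 : S.g) := by
    refine Filter.inter_mem ((S.continuous_dtau Y).continuousAt.preimage_mem_nhds ?_)
      (hhalf.continuousAt.preimage_mem_nhds ?_)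
    · rwa [hdt0]
    · rwa [hexp0]
  obtain ⟨U₁, hU₁, hsub⟩ := mem_nhds_subtype _ _ _ |>.1 hN
  have hev := eventually_exists_glExp_eq S.isClosed_map_subtype (W := S.g.toSubmodule)
    (U := {X | -X ∈ U₀} ∩ U₁) S.coe_g (Filter.inter_mem hneg hU₁)
  filter_upwards [continuous_subtype_val.continuousAt.eventually hev] with u hu huG hτu
  obtain ⟨X, hXg, ⟨hX1, hX2⟩, hXu⟩ := hu (S.mem_map_subtype_iff.2 huG)
  obtain ⟨hX3, hX4⟩ := hsub (show (⟨X, hXg⟩ : S.g) ∈ Subtype.val ⁻¹' U₁ from hX2)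
  set Z : S.g := ⟨X, hXg⟩ with hZ
  have hu' : u = S.expC Z 0 := by
    ext1
    rw [coe_expC_zero, ← hXu]
  -- Both sides exponentiate to `τ(u) = u⁻¹` and lie in `U₀`, where `exp` is injective.
  have hdt : S.dtau Y Z = -X := by
    refine hinj hX3 hX1 ?_
    rw [dtau_eq, ← coe_tau_expC, ← hu', hτu, glExp_neg, hXu, Subgroup.coe_inv]
  -- For `v = exp (X/2)`, `τ(v) = exp (-X/2)`, so `v τ(v)⁻¹ = exp X`.
  refine ⟨S.expC ((1 / 2 : ℝ) • Z) 0, S.expC_mem_G _, hX4, ?_⟩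
  ext1
  rw [Subgroup.coe_mul, Subgroup.coe_inv, coe_tau_expC, map_smul, coe_g_smul,
    LinearMap.map_smul_of_tower, ← dtau_eq, hdt, coe_expC_zero, coe_g_smul, ← glExp_neg,
    ← glExp_add (by rw [smul_neg, neg_neg]), hu', coe_expC_zero]
  congr 1
  change (1 / 2 : ℝ) • X + -((1 / 2 : ℝ) • -X) = X
  module

/-! ### The orbit of `z'` -/

theorem smul_z' (Y : S.𝔞) (u : S.G) :
    u • S.z' Y = (QuotientGroup.mk ((u : S.GC) * S.z Y) : S.GC ⧸ S.KC) := rfl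

/-- `u` fixes `z'` exactly when `z⁻¹ u z` is `Θ`-fixed; by `Θ(z) = z⁻¹` this says `z² Θ(u) z⁻² = u`.
-/
theorem stabilizer_z' (hK : S.KC = S.fixedGC) (Y : S.𝔞) :
    MulAction.stabilizer S.G (S.z' Y) = S.Gtau Y := by
  ext u
  rw [MulAction.mem_stabilizer_iff, smul_z', z', eq_comm, QuotientGroup.eq, hK]
  change S.Θ ((S.z Y)⁻¹ * (u * S.z Y)) = (S.z Y)⁻¹ * (u * S.z Y) ↔ S.tau Y u = u
  rw [tau_apply, map_mul, map_mul, map_inv, Θ_z, inv_inv, pow_two]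
  constructor
  · intro h
    rw [← mul_assoc, mul_inv_eq_iff_eq_mul] at h
    calc S.z Y * S.z Y * S.Θ u * (S.z Y * S.z Y)⁻¹
        = S.z Y * (S.z Y * S.Θ u) * (S.z Y * S.z Y)⁻¹ := by group
      _ = u := by rw [h]; group
  · intro h
    rw [mul_inv_eq_iff_eq_mul] at h
    calc S.z Y * (S.Θ u * (S.z Y)⁻¹)
        = (S.z Y)⁻¹ * (S.z Y * S.z Y * S.Θ u) * (S.z Y)⁻¹ := by group
      _ = (S.z Y)⁻¹ * (u * S.z Y) := by rw [h]; group

/-- The map `u K_ℂ ↦ u Θ(u)⁻¹` on `G_ℂ / K_ℂ`. -/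
noncomputable def cartanMap (hK : S.KC = S.fixedGC) : S.GC ⧸ S.KC → S.GC :=
  Quotient.lift (fun u : S.GC => u * (S.Θ u)⁻¹) (by
    intro u v huv
    have h : u⁻¹ * v ∈ S.KC := QuotientGroup.leftRel_apply.1 huv
    rw [hK] at h
    have h' : S.Θ (u⁻¹ * v) = u⁻¹ * v := h
    rw [map_mul, map_inv, inv_mul_eq_iff_eq_mul] at h'
    change u * (S.Θ u)⁻¹ = v * (S.Θ v)⁻¹
    rw [h']
    group)

theorem continuous_cartanMap (hK : S.KC = S.fixedGC) : Continuous (S.cartanMap hK) := by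
  have := S.continuous_Θ
  exact Continuous.quotient_lift (by fun_prop) _

/-- This makes `u τ(u)⁻¹` a continuous function of the orbit point `u z'`, which is how nearness to
`z'` is transferred to the group. -/
theorem cartanMap_smul_z' (hK : S.KC = S.fixedGC) (Y : S.𝔞) (u : S.G) :
    S.cartanMap hK (u • S.z' Y) * (S.z Y ^ 2)⁻¹ = u * (S.tau Y u)⁻¹ := by
  change (u * S.z Y) * (S.Θ (u * S.z Y))⁻¹ * (S.z Y ^ 2)⁻¹ = _
  simp only [tau_apply, map_mul, Θ_z, pow_two, mul_inv_rev, inv_inv, mul_assoc]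

theorem exists_homeomorph_orbit_z' (hK : S.KC = S.fixedGC) {Y : S.𝔞}
    (h : ∀ u ∈ S.G, S.tau Y u ∈ S.G) :
    ∃ Φ : (S.G ⧸ S.Gtau Y) ≃ₜ MulAction.orbit S.G (S.z' Y),
      (∀ (u : S.G) (x : S.G ⧸ S.Gtau Y), Φ (u • x) = u • Φ x) ∧
      (Φ (QuotientGroup.mk 1) : S.GC ⧸ S.KC) = S.z' Y := by
  rw [← S.stabilizer_z' hK]
  refine exists_homeomorph_orbit _ fun U hU => ?_
  obtain ⟨U', hU', hsub⟩ := (mem_nhds_subtype _ _ _).1 hU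
  have hc : Continuous fun x => S.cartanMap hK x * (S.z Y ^ 2)⁻¹ :=
    (S.continuous_cartanMap hK).mul continuous_const
  have h1 := hc.tendsto (S.z' Y)
  have hbase : S.cartanMap hK (S.z' Y) * (S.z Y ^ 2)⁻¹ = 1 := by
    have := S.cartanMap_smul_z' hK Y 1
    simpa using this
  rw [hbase] at h1
  filter_upwards [h1.eventually (S.eventually_exists_mul_inv_tau_eq Y hU')] with x hx hxo
  obtain ⟨u, rfl⟩ := hxo
  simp only [cartanMap_smul_z'] at hx
  obtain ⟨v, hvG, hvU, hv⟩ := hx (mul_mem u.2 (inv_mem (h _ u.2))) (by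
    rw [map_mul, map_inv, tau_tau]
    group)
  refine ⟨⟨v, hvG⟩, hsub hvU, ?_⟩
  change (⟨v, hvG⟩ : S.G) • S.z' Y = u • S.z' Y
  -- `v τ(v)⁻¹ = u τ(u)⁻¹` says that `u⁻¹ v` is fixed by `τ`, hence stabilizes `z'`.
  rw [← inv_smul_eq_iff, smul_smul, ← MulAction.mem_stabilizer_iff, S.stabilizer_z' hK]
  change S.tau Y ((u : S.GC)⁻¹ * v) = (u : S.GC)⁻¹ * v
  rw [mul_inv_eq_iff_eq_mul] at hv
  rw [map_mul, map_inv, inv_mul_eq_iff_eq_mul]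
  nth_rewrite 2 [hv]
  group

end CrownSetting
theorem theorem3p5 {n : Type*} [Fintype n] [DecidableEq n] (S : CrownSetting n)
    (hnc : ∃ X : S.g, S.θ X ≠ X) (Y : S.𝔞) (hY : Y ∈ extremeOmega S.𝔞) :
    ((∀ X : S.g, S.dtau Y X ∈ S.g) →
      spectrum ℂ ((LieAlgebra.ad ℝ S.g (Y : S.g)).baseChange ℂ) =
          {-((π / 2 : ℝ) : ℂ), 0, ((π / 2 : ℝ) : ℂ)} ∧
        S.TauNonCompactlyCausal Y) ∧
    ((∀ u ∈ S.G, S.tau Y u ∈ S.G) →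
      (∀ u ∈ S.G, S.tau Y (S.tau Y u) = u) ∧
      S.TauNonCompactlyCausal Y ∧
      MulAction.orbit S.G (S.z' Y) ⊆ S.distinguishedBoundary ∧
      (S.KC = S.fixedGC →
        ∃ Φ : (S.G ⧸ S.Gtau Y) ≃ₜ MulAction.orbit S.G (S.z' Y),
          (∀ (u : S.G) (x : S.G ⧸ S.Gtau Y), Φ (u • x) = u • Φ x) ∧
          (Φ (QuotientGroup.mk 1) : S.GC ⧸ S.KC) = S.z' Y)) := by
  have hspec : (∀ X : S.g, S.dtau Y X ∈ S.g) →
      spectrum ℂ ((LieAlgebra.ad ℝ S.g (Y : S.g)).baseChange ℂ) =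
          {-((π / 2 : ℝ) : ℂ), 0, ((π / 2 : ℝ) : ℂ)} := fun h => by
    have hY0 := ne_zero_of_mem_extremeOmega S.isCartan S.maximal_𝔞 hnc hY
    exact spectrum_ad_of_cubic S.isCartan (S.θ_coe Y) (by simpa using hY0)
      fun X => (S.cubic_and_dtau_of_dtau_mem hY h X).1
  refine ⟨fun h => ⟨hspec h, S.tauNonCompactlyCausal hnc hY h⟩, fun h => ⟨fun u _ => S.tau_tau Y u,
    S.tauNonCompactlyCausal hnc hY (S.dtau_mem_of_tau_mem h), ?_,
    fun hK => S.exists_homeomorph_orbit_z' hK h⟩⟩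
  rintro _ ⟨u, rfl⟩
  exact ⟨u, Y, hY, rfl⟩
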